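/- Let $m\ge 0$ and $n\ge 1$ be integers, let $\lambda/\mu$ be a skew-partition of $mn$ (that is, $\mu\subseteq\lambda$ are partitions with $|\lambda|-|\mu|=mn$), and let $\alpha$ be a partition of $m$. Let $n\alpha$ be the partition of $mn$ obtained by multiplying each part of $\alpha$ by $n$, and for a partition $\beta$ of $r$ let $g_\beta\in S_r$ be any element of cycle type $\beta$. Let $\chi^{\lambda/\mu}$ denote the skew character of $S_{|\lambda/\mu|}$ labelled by $\lambda/\mu$, that is, the class function $$\chi^{\lambda/\mu}=\sum_{\pi\in S_k}\operatorname{sgn}(\pi)\,\xi^{\gamma_\pi},\qquad (\gamma_\pi)_i=\lambda_i-i-\mu_{\pi(i)}+\pi(i)\quad(1\le i\le k),$$ where $k$ is the number of parts of $\lambda$, and $\xi^\gamma$ is the character induced from the trivial character of the Young subgroup $S_{\gamma_1}\times\cdots\times S_{\gamma_k}$ (and $\xi^\gamma=0$ if some $\gamma_i<0$). A border strip is a skew-partition whose Young diagram is non-empty, connected (through edges) and contains no $2\times2$ square. We say that $\lambda/\mu$ is $n$-decomposable if the boxes of its Young diagram can be labelled by $1,\dots,m$ so that rows and columns are non-decreasing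 and, for each $j\in\{1,\dots,m\}$, the boxes labelled $j$ form a border strip with exactly $n$ boxes. Let $t\ge 0$ be any integer such that $\lambda$ has at most $tn$ parts. For a partition $\nu$ with at most $tn$ parts, consider its display on an $n$-runner abacus with $tn$ beads, at the positions $\nu_i+tn-i$ for $1\le i\le tn$; position $p$ lies on runner $p \bmod n$, in row $\lfloor p/n\rfloor$. The beads are numbered $1,\dots,tn$ in increasing order of position, and the level of a bead is the number of beads above it on its runner, i.e. at smaller positions. For $0\le i<n$ let $\nu^{(i)}$ be the partition whose parts are the non-zero numbers among the numbers of gaps above each of the beads of runner $i$, on that runner. **Theorem (Farahat).** 1. If $\lambda/\mu$ is not $n$-decomposable, then $\chi^{\lambda/\mu}(g_{n\alpha})=0$. 2. If $\lambda/\mu$ is $n$-decomposable, then $\mu^{(i)}\subseteq\lambda^{(i)}$ for every $i$, the sizes $\ell_i=|\lambda^{(i)}/\mu^{(i)}|$ satisfy $\ell_0+\cdots+\ell_{n-1}=m$, and there is a unique permutation $\rho\in S_{tn}$ such that, for every $b$, the bead numbered $b$ in the display of $\lambda$ has the same level and lies on the same runner as the bead numbered $\rho(b)$ in the display of $\mu$.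 Setting $\epsilon_n(\lambda/\mu)=\operatorname{sgn}\rho$, we have $$\chi^{\lambda/\mu}(g_{n\alpha})=\epsilon_n(\lambda/\mu)\,\operatorname{Ind}^{S_m}_{S_{\ell_0}\times\cdots\times S_{\ell_{n-1}}}\bigl(\chi^{\lambda^{(0)}/\mu^{(0)}}\times\cdots\times\chi^{\lambda^{(n-1)}/\mu^{(n-1)}}\bigr)(g_\alpha).$$ -/

import Mathlib

namespace SkewChar

/-- A skew-partition `λ / μ`: two partitions (as Young diagrams in English notation, with cells
`(row, column)` numbered from `0`) such that `μ` is contained in `λ`. -/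
structure SkewPartition where
  /-- the partition `λ` -/
  outer : YoungDiagram
  /-- the partition `μ` -/
  inner : YoungDiagram
  le : inner ≤ outer

namespace SkewPartition

/-- The Young diagram of `λ / μ`, as a set of boxes. -/
def cells (s : SkewPartition) : Finset (ℕ × ℕ) := s.outer.cells \ s.inner.cells

/-- The size `|λ / μ|`. -/
def size (s : SkewPartition) : ℕ := s.cells.card

/-- A skew-partition is a border strip if its Young diagram is connected (with respect to boxes
sharing an edge; in particular it is nonempty) and contains no `2 × 2` square. -/
def IsBorderStrip (s : SkewPartition) : Prop :=
  ((SimpleGraph.hasse ℕ □ SimpleGraph.hasse ℕ).induce (s.cells : Set (ℕ × ℕ))).Connected ∧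
  ¬ ∃ i j : ℕ, (i, j) ∈ s.cells ∧ (i, j + 1) ∈ s.cells ∧
      (i + 1, j) ∈ s.cells ∧ (i + 1, j + 1) ∈ s.cells

/-- `T` is a border-strip tableau of shape `s` and type `(γ 0, …, γ (k - 1))`: an assignment of
labels `0, …, k - 1` to the boxes of `s` such that rows and columns are non-decreasing and, for
each label `j`, the boxes labelled `j` form a border strip of length `γ j`. -/
structure IsBorderStripTableau (s : SkewPartition) {k : ℕ} (γ : Fin k → ℕ)
    (T : s.cells → Fin k) : Prop where
  row_le : ∀ a b : s.cells, a.1.1 = b.1.1 → a.1.2 ≤ b.1.2 → T a ≤ T b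
  col_le : ∀ a b : s.cells, a.1.2 = b.1.2 → a.1.1 ≤ b.1.1 → T a ≤ T b
  strip : ∀ j : Fin k, ∃ u : SkewPartition, u.IsBorderStrip ∧ u.size = γ j ∧
    ∀ c : ℕ × ℕ, c ∈ u.cells ↔ ∃ h : c ∈ s.cells, T ⟨c, h⟩ = j

/-- A skew-partition of `m * n` is `n`-decomposable if it has a border-strip tableau of type
`(n, …, n)`, with `m` parts. -/
def IsDecomposable (s : SkewPartition) (m n : ℕ) : Prop :=
  ∃ T : s.cells → Fin m, s.IsBorderStripTableau (fun _ => n) T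

end SkewPartition

/-! ### Induced characters and skew characters -/

/-- The class function on `G` induced from the class function `φ` on `H`, where `H` is regarded as
a subgroup of `G` through an injective homomorphism `f`:
`g ↦ |H|⁻¹ ∑_{x ∈ G, x⁻¹ g x ∈ H} φ (x⁻¹ g x)`. -/
noncomputable def inducedClassFunction {H G : Type} [Group H] [Fintype H] [Group G] [Fintype G]
    [DecidableEq G] (f : H →* G) (φ : H → ℂ) (g : G) : ℂ :=
  (Fintype.card H : ℂ)⁻¹ * ∑ x : G, ∑ h : H, if f h = x⁻¹ * g * x then φ h else 0

/-- The embedding `S_{ℓ 0} × ⋯ × S_{ℓ (k - 1)} → S_r` as a Young subgroup, where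
`ℓ 0 + ⋯ + ℓ (k - 1) = r`: the factors permute consecutive intervals of lengths `ℓ 0, ℓ 1, …`. -/
def youngEmbedding {k r : ℕ} (ℓ : Fin k → ℕ) (h : ∑ i, ℓ i = r) :
    (∀ i, Equiv.Perm (Fin (ℓ i))) →* Equiv.Perm (Fin r) :=
  ((finSigmaFinEquiv.trans (finCongr h)).permCongrHom).toMonoidHom.comp
    (Equiv.Perm.sigmaCongrRightHom fun i => Fin (ℓ i))

/-- The class function `Ind (θ 0 × ⋯ × θ (k - 1))` on `S_r`, induced from the Young subgroup
`S_{ℓ 0} × ⋯ × S_{ℓ (k - 1)}`. -/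
noncomputable def youngInduced {k r : ℕ} (ℓ : Fin k → ℕ) (h : ∑ i, ℓ i = r)
    (θ : ∀ i, Equiv.Perm (Fin (ℓ i)) → ℂ) : Equiv.Perm (Fin r) → ℂ :=
  inducedClassFunction (youngEmbedding ℓ h) fun x => ∏ i, θ i (x i)

open Classical in
/-- The Young permutation character `ξ^γ` of `S_r`, induced from the trivial character of the Young
subgroup `S_{γ 0} × ⋯ × S_{γ (k - 1)}`, for an integer vector `γ` of sum `r`. By the usual
convention it is zero if some entry of `γ` is negative. -/
noncomputable def youngPermChar {k : ℕ} (r : ℕ) (γ : Fin k → ℤ) (g : Equiv.Perm (Fin r)) : ℂ :=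
  if h : (∀ i, 0 ≤ γ i) ∧ ∑ i, (γ i).toNat = r then
    youngInduced (fun i => (γ i).toNat) h.2 (fun _ _ => 1) g
  else 0

/-- The skew character `χ^{λ / μ}` of the symmetric group of degree `|λ / μ|`, defined by the
determinantal form of James and Kerber:
`χ^{λ/μ} = ∑_π sgn π · ξ^{(λ_i - i - μ_{π i} + π i)_i}`, where `i` runs over the rows of `λ` and
`π` over their permutations. That is, it is the determinant of the matrix of the trivial characters
of the symmetric groups of degrees `λ_i - μ_j - i + j` for the induction product, which corresponds
to the Jacobi-Trudi determinant of the skew Schur function `s_{λ/μ}` under the Frobenius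
characteristic map. For `μ = ∅` it is the irreducible character `χ^λ`. -/
noncomputable def skewCharacter (s : SkewPartition) (g : Equiv.Perm (Fin s.size)) : ℂ :=
  ∑ π : Equiv.Perm (Fin (s.outer.colLen 0)), ((Equiv.Perm.sign π : ℤ) : ℂ) *
    youngPermChar s.size
      (fun i => (s.outer.rowLen i : ℤ) - (i : ℕ) - (s.inner.rowLen (π i) : ℤ) + (π i : ℕ)) g

/-! ### The abacus, quotients and signs -/

/-- The abacus display of a partition with `N` beads, where `N` is at least the number of parts:
the position (a natural number) of the bead numbered `b` in the natural numbering, that is, in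
increasing order of positions (see `beadPos_strictMono`). The beads are at `λ_i + N - 1 - i`, for
`0 ≤ i < N`, and the bead numbered `b` comes from the row `i = N - 1 - b`. On an `n`-runner abacus
position `p` is in row `p / n` of runner `p % n`. -/
def beadPos (ν : YoungDiagram) (N : ℕ) (b : Fin N) : ℕ := ν.rowLen (N - 1 - b) + b

theorem beadPos_strictMono (ν : YoungDiagram) (N : ℕ) : StrictMono (beadPos ν N) := by
  intro a b hab
  have h1 : (a : ℕ) < b := hab
  have h2 := ν.rowLen_anti (N - 1 - b) (N - 1 - a) (by omega)
  unfold beadPos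
  omega

/-- The number of gaps before position `p`, for beads in the positions `B`. -/
def gapsBefore (B : Finset ℕ) (p : ℕ) : ℕ := ((Finset.range p).filter (· ∉ B)).card

theorem gapsBefore_mono (B : Finset ℕ) : Monotone (gapsBefore B) := by
  intro p q h
  exact Finset.card_le_card (Finset.filter_subset_filter _ (Finset.range_mono h))

/-- The partition represented by a one-runner abacus with beads in the positions `B`: its parts
(some of which may be `0`) are the numbers of gaps before the beads, from the last bead to the
first. -/
def partitionOfBeads (B : Finset ℕ) : YoungDiagram :=
  YoungDiagram.ofRowLens ((B.sort (· ≥ ·)).map (gapsBefore B)) (by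
    refine List.Pairwise.sortedGE ?_
    exact (B.pairwise_sort (· ≥ ·)).map _ fun _ _ h => gapsBefore_mono B h)

/-- The `i`-th component of the `n`-quotient of a partition, read off from runner `i` of its
`n`-runner abacus display with `N` beads. -/
def quotientComponent (ν : YoungDiagram) (N n : ℕ) (i : Fin n) : YoungDiagram :=
  partitionOfBeads
    (((Finset.univ.image (beadPos ν N)).filter (fun p => p % n = i)).image (fun p => p / n))

/-- The level of the bead numbered `b`: the number of beads above it on its runner. -/
def level (ν : YoungDiagram) (N n : ℕ) (b : Fin N) : ℕ :=
  (Finset.univ.filter fun c : Fin N =>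
    beadPos ν N c % n = beadPos ν N b % n ∧ beadPos ν N c < beadPos ν N b).card

/-- `ρ` is the relabelling permutation associated to the `n`-runner abacus displays of `λ` and `μ`
with `N` beads: the bead numbered `b` for `λ` lies on the same runner and has the same level as the
bead numbered `ρ b` for `μ`. -/
def IsRelabelling (s : SkewPartition) (N n : ℕ) (ρ : Equiv.Perm (Fin N)) : Prop :=
  ∀ b : Fin N, beadPos s.outer N b % n = beadPos s.inner N (ρ b) % n ∧
    level s.outer N n b = level s.inner N n (ρ b)

/-- The `i`-th component `λ^{(i)} / μ^{(i)}` of the `n`-quotient of `λ / μ`, for abacus displays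
with `N` beads. -/
def skewQuotient (s : SkewPartition) (N n : ℕ)
    (hle : ∀ i : Fin n, quotientComponent s.inner N n i ≤ quotientComponent s.outer N n i)
    (i : Fin n) : SkewPartition :=
  ⟨quotientComponent s.outer N n i, quotientComponent s.inner N n i, hle i⟩

end SkewChar

/-!
The value at `g` of the Young permutation character `ξ^γ` is the number of colourings of the points
that are constant on the cycles of `g` and use the colour `k` exactly `γ k` times
(`youngPermChar_eq_card`), and inducing a product of such characters from a Young subgroup
concatenates their types (`youngInduced_card_invColorings`). If the cycle lengths of `g` are `n`
times those of `h`, then `ξ^γ (g)` is zero unless `n` divides every `γ k`, and `ξ^{nγ} (g) = ξ^γ (h)`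
(`invColorings_eq_empty_of_not_dvd`, `card_invColorings_mul`).

A skew character is the alternating sum of the `ξ^γ` with `γ_b = a_b - a'_{π b}`, where `a` and `a'`
are the bead positions of `λ` and `μ` and `π` runs over the permutations of the beads; the number of
beads does not matter as long as it is large enough (`skewCharacter_eq_altColoringSum`). At `g` only
the `π` that match beads on the same runner, at least as far up for `μ`, contribute. Two consequences
follow. If there is no such `π`, the value is zero. If the runners carry equally many beads, the
relabelling permutation `ρ` splits off with its sign, and the remaining sum runs over families of
permutations of the single runners (`altColoringSum_runners`); the runners are the displays of the
components of the quotients, so this is the induced product of their skew characters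
(`youngInduced_skewQuotient`).

It remains to see that `λ / μ` is `n`-decomposable exactly when the beads of `λ` dominate those of
`μ` runner by runner, in the sense of `Dominates`. The cells of `λ` on a diagonal are counted by the
beads beyond a position (`mem_iff_lt_beadsFrom`). A skew shape is a border strip of size `n` exactly
when it has one cell on each of `n` consecutive diagonals and no other cells, which says that a bead
moves up by one row on its runner (`exists_beadsFrom_of_isBorderStrip`, `isBorderStrip_of_beadsFrom`,
`eq_move_of_beadsFrom`). Removing the strips of a tableau one by one moves beads up, and conversely
strict dominance always leaves a bead that can be moved up (`Dominates.exists_move`).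
-/

open SkewChar

/-! ### Invariant colourings and Young permutation characters -/

/-- The colourings of `X` by `K` that are constant on the cycles of the permutation `g` and use
each colour `k` exactly `γ k` times. Their number is the value at `g` of the Young permutation
character `ξ^γ`. Negative entries of `γ` are allowed, and then there are no such colourings. -/
def invColorings {X K : Type*} [Fintype X] [DecidableEq X] [Fintype K] [DecidableEq K]
    (g : Equiv.Perm X) (γ : K → ℤ) : Finset (X → K) :=
  Finset.univ.filter fun c => (∀ x, c (g x) = c x) ∧
    ∀ k, ((Finset.univ.filter fun x => c x = k).card : ℤ) = γ k

theorem mem_invColorings {X K : Type*} [Fintype X] [DecidableEq X] [Fintype K] [DecidableEq K]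
    {g : Equiv.Perm X} {γ : K → ℤ} {c : X → K} :
    c ∈ invColorings g γ ↔ (∀ x, c (g x) = c x) ∧
      ∀ k, ((Finset.univ.filter fun x => c x = k).card : ℤ) = γ k := by
  simp [invColorings]

theorem invColorings_eq_empty_of_neg {X K : Type*} [Fintype X] [DecidableEq X] [Fintype K]
    [DecidableEq K] (g : Equiv.Perm X) {γ : K → ℤ} {k : K} (hk : γ k < 0) :
    invColorings g γ = ∅ := by
  refine Finset.eq_empty_of_forall_notMem fun c hc => ?_
  have := (mem_invColorings.1 hc).2 k
  omega

/-- A permutation of a disjoint union of finite sets that maps each of them to itself is a family of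
permutations. -/
theorem exists_sigmaCongrRight_eq {ι : Type*} {A : ι → Type*} [∀ i, Finite (A i)]
    (σ : Equiv.Perm (Σ i, A i)) (h : ∀ z, (σ z).1 = z.1) :
    ∃ F : ∀ i, Equiv.Perm (A i), Equiv.Perm.sigmaCongrRight F = σ := by
  have h' : ∀ i (j : A i), ∃ j', σ ⟨i, j⟩ = ⟨i, j'⟩ := by
    intro i j
    have := h ⟨i, j⟩
    rcases hz : σ ⟨i, j⟩ with ⟨i', j'⟩
    rw [hz] at this
    obtain rfl : i' = i := this
    exact ⟨j', rfl⟩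
  choose f hf using h'
  have hinj : ∀ i, Function.Injective (f i) := by
    intro i a b hab
    have : σ ⟨i, a⟩ = σ ⟨i, b⟩ := by rw [hf, hf, hab]
    simpa using σ.injective this
  refine ⟨fun i => Equiv.ofBijective (f i) (Finite.injective_iff_bijective.1 (hinj i)), ?_⟩
  ext1 ⟨i, j⟩
  rw [hf]
  rfl

/-- If the fibres of `d` have the sizes `ℓ i` of the blocks of a Young subgroup, then the number of
permutations that carry the blocks to the fibres is the order of the Young subgroup. -/
theorem card_perm_compatible {k r : ℕ} {ℓ : Fin k → ℕ} (e : (Σ i, Fin (ℓ i)) ≃ Fin r)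
    (d : Fin r → Fin k) (hd : ∀ i, (Finset.univ.filter fun y => d y = i).card = ℓ i) :
    (Finset.univ.filter fun x : Equiv.Perm (Fin r) => ∀ z, d (x (e z)) = z.1).card =
      Fintype.card (∀ i, Equiv.Perm (Fin (ℓ i))) := by
  classical
  have hd' : ∀ i, Fintype.card {y // d y = i} = ℓ i := fun i => by
    rw [Fintype.card_subtype, hd]
  let e₀ : (Σ i, Fin (ℓ i)) ≃ Fin r :=
    (Equiv.sigmaCongrRight fun i => (Fintype.equivFinOfCardEq (hd' i)).symm).trans
      (Equiv.sigmaFiberEquiv d)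
  have he₀ : ∀ z, d (e₀ z) = z.1 := fun z => ((Fintype.equivFinOfCardEq (hd' z.1)).symm z.2).2
  have hstab := DomMulAct.stabilizer_card (fun y => (e.symm y).1)
  have hfib : ∀ i, Fintype.card {y // (e.symm y).1 = i} = ℓ i := by
    intro i
    have h1 : {y // (e.symm y).1 = i} ≃ {z : Σ i, Fin (ℓ i) // z.1 = i} :=
      e.symm.subtypeEquiv fun y => Iff.rfl
    rw [Fintype.card_congr (h1.trans (Equiv.sigmaSubtype i)), Fintype.card_fin]
  simp only [hfib] at hstab
  rw [Fintype.card_pi]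
  simp only [Fintype.card_perm, Fintype.card_fin]
  rw [← hstab, Fintype.card_subtype]
  refine Finset.card_bij' (fun x _ => (e.symm.trans e₀)⁻¹ * x) (fun u _ => (e.symm.trans e₀) * u)
    ?_ ?_ ?_ ?_
  · intro x hx
    simp only [Finset.mem_filter, Finset.mem_univ, true_and] at hx ⊢
    funext y
    have h1 := hx (e.symm y)
    rw [e.apply_symm_apply] at h1
    simp only [Function.comp, Equiv.Perm.mul_apply]
    rw [← h1, ← he₀]
    congr 1
    simp [Equiv.Perm.inv_def]
  · intro u hu
    simp only [Finset.mem_filter, Finset.mem_univ, true_and] at hu ⊢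
    intro z
    have h1 := congrFun hu (e z)
    simp only [Function.comp, e.symm_apply_apply] at h1
    simp only [Equiv.Perm.mul_apply, Equiv.trans_apply]
    rw [he₀, h1]
  · intro x _
    simp
  · intro u _
    simp

theorem youngEmbedding_apply {k r : ℕ} (ℓ : Fin k → ℕ) (h : ∑ i, ℓ i = r)
    (y : ∀ i, Equiv.Perm (Fin (ℓ i))) (z : Fin r) :
    youngEmbedding ℓ h y z = (finSigmaFinEquiv.trans (finCongr h))
      (Equiv.Perm.sigmaCongrRight y ((finSigmaFinEquiv.trans (finCongr h)).symm z)) := rfl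

/-- For a fixed `x`, the colourings in the blocks of the Young subgroup that are invariant under
the components of `x⁻¹ g x` glue to the invariant colourings for `g` whose colour classes are
compatible with the blocks. -/
theorem sum_youngEmbedding_eq_card {k r : ℕ} (ℓ : Fin k → ℕ) (h : ∑ i, ℓ i = r)
    {K : Fin k → Type} [∀ i, Fintype (K i)] [∀ i, DecidableEq (K i)] (δ : ∀ i, K i → ℤ)
    (g x : Equiv.Perm (Fin r)) :
    (∑ y : ∀ i, Equiv.Perm (Fin (ℓ i)), if youngEmbedding ℓ h y = x⁻¹ * g * x then
        ∏ i, (invColorings (y i) (δ i)).card else 0) =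
      ((invColorings g fun z : Σ i, K i => δ z.1 z.2).filter fun c =>
        ∀ z, (c (x ((finSigmaFinEquiv.trans (finCongr h)) z))).1 = z.1).card := by
  classical
  set e := finSigmaFinEquiv.trans (finCongr h) with he
  rw [← Finset.sum_filter]
  simp only [← Fintype.card_piFinset]
  rw [← Finset.card_sigma]
  have hconj : ∀ y, youngEmbedding ℓ h y = x⁻¹ * g * x →
      ∀ z, g (x (e z)) = x (e (Equiv.Perm.sigmaCongrRight y z)) := by
    intro y hy z
    have h1 := congrArg (fun u : Equiv.Perm (Fin r) => x (u (e z))) hy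
    simp only [youngEmbedding_apply, ← he, e.symm_apply_apply, Equiv.Perm.mul_apply,
      Equiv.Perm.inv_def, Equiv.apply_symm_apply] at h1
    exact h1.symm
  have hsurj : ∀ t : Fin r, ∃ z, t = x (e z) := fun t => ⟨e.symm (x⁻¹ t), by simp⟩
  let glue : (∀ i, Fin (ℓ i) → K i) → Fin r → Σ i, K i := fun C t =>
    (fun z : Σ i, Fin (ℓ i) => (⟨z.1, C z.1 z.2⟩ : Σ i, K i)) (e.symm (x⁻¹ t))
  have hglue : ∀ C z, glue C (x (e z)) = ⟨z.1, C z.1 z.2⟩ := by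
    intro C z
    have hz : e.symm (x⁻¹ (x (e z))) = z := by simp
    change (fun z : Σ i, Fin (ℓ i) => (⟨z.1, C z.1 z.2⟩ : Σ i, K i)) (e.symm (x⁻¹ (x (e z)))) = _
    rw [hz]
  have hfib : ∀ (c : Fin r → Σ i, K i) (C : ∀ i, Fin (ℓ i) → K i),
      (∀ i j, c (x (e ⟨i, j⟩)) = ⟨i, C i j⟩) → ∀ i k',
      (Finset.univ.filter fun t => c t = ⟨i, k'⟩).card =
        (Finset.univ.filter fun j => C i j = k').card := by
    intro c C hc i k'
    symm
    refine Finset.card_bij (fun j _ => x (e ⟨i, j⟩)) ?_ ?_ ?_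
    · intro j hj
      simp only [Finset.mem_filter, Finset.mem_univ, true_and] at hj ⊢
      rw [hc, hj]
    · intro j _ j' _ hjj
      simpa using hjj
    · intro t ht
      simp only [Finset.mem_filter, Finset.mem_univ, true_and] at ht
      obtain ⟨⟨i', j⟩, rfl⟩ := hsurj t
      rw [hc] at ht
      obtain ⟨rfl, ht⟩ := Sigma.mk.inj_iff.1 ht
      exact ⟨j, by simpa using ht, rfl⟩
  refine Finset.card_bij (fun p _ => glue p.2) ?_ ?_ ?_
  · rintro ⟨y, C⟩ hp
    simp only [Finset.mem_sigma, Finset.mem_filter, Finset.mem_univ, true_and,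
      Fintype.mem_piFinset, mem_invColorings] at hp ⊢
    obtain ⟨hy, hC⟩ := hp
    refine ⟨⟨?_, ?_⟩, ?_⟩
    · intro t
      obtain ⟨⟨i, j⟩, rfl⟩ := hsurj t
      rw [hconj y hy, hglue, hglue]
      change (⟨i, C i (y i j)⟩ : Σ i, K i) = ⟨i, C i j⟩
      rw [(hC i).1]
    · rintro ⟨i, k'⟩
      rw [hfib _ C (fun i j => hglue C ⟨i, j⟩), (hC i).2]
    · intro z
      rw [hglue]
  · rintro ⟨y, C⟩ hp ⟨y', C'⟩ hp' heq
    simp only [Finset.mem_sigma, Finset.mem_filter, Finset.mem_univ, true_and] at hp hp'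
    obtain rfl : C = C' := by
      funext i j
      have h1 := congrFun heq (x (e ⟨i, j⟩))
      rw [hglue, hglue] at h1
      simpa using h1
    obtain rfl : y = y' := by
      apply Equiv.Perm.sigmaCongrRightHom_injective
      refine Equiv.ext fun z => ?_
      have h1 := (hconj y hp.1 z).symm.trans (hconj y' hp'.1 z)
      exact e.injective (x.injective h1)
    rfl
  · intro c hc
    simp only [Finset.mem_filter, mem_invColorings] at hc
    obtain ⟨⟨hcg, hcf⟩, hcx⟩ := hc
    have h1 : ∀ z, ((e.permCongr.symm (x⁻¹ * g * x)) z).1 = z.1 := by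
      intro z
      rw [← hcx, ← hcx z, ← hcg (x (e z))]
      simp [Equiv.permCongr_symm]
    obtain ⟨y, hy⟩ := exists_sigmaCongrRight_eq _ h1
    have h2 : ∀ i (j : Fin (ℓ i)), ∃ j', c (x (e ⟨i, j⟩)) = ⟨i, j'⟩ := by
      intro i j
      have := hcx ⟨i, j⟩
      rcases hz : c (x (e ⟨i, j⟩)) with ⟨i', j'⟩
      rw [hz] at this
      obtain rfl : i' = i := this
      exact ⟨j', rfl⟩
    choose C hC using h2
    have hyg : youngEmbedding ℓ h y = x⁻¹ * g * x := by
      refine Equiv.ext fun t => ?_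
      rw [youngEmbedding_apply, ← he, hy]
      simp [Equiv.permCongr_symm]
    refine ⟨⟨y, C⟩, ?_, ?_⟩
    · simp only [Finset.mem_sigma, Finset.mem_filter, Finset.mem_univ, true_and,
        Fintype.mem_piFinset, mem_invColorings]
      refine ⟨hyg, fun i => ⟨fun j => ?_, fun k' => ?_⟩⟩
      · have h3 := hcg (x (e ⟨i, j⟩))
        rw [hconj y hyg] at h3
        simp only [Equiv.Perm.sigmaCongrRight, Equiv.sigmaCongrRight_apply] at h3
        rw [hC, hC] at h3
        simpa using h3
      · rw [← hfib c C hC, hcf]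
    · funext t
      obtain ⟨⟨i, j⟩, rfl⟩ := hsurj t
      rw [hglue, hC]

/-- Transitivity of induction for permutation characters: inducing a product of Young permutation
characters from a Young subgroup concatenates their types. -/
theorem youngInduced_card_invColorings {k r : ℕ} (ℓ : Fin k → ℕ) (h : ∑ i, ℓ i = r)
    {K : Fin k → Type} [∀ i, Fintype (K i)] [∀ i, DecidableEq (K i)] (δ : ∀ i, K i → ℤ)
    (hδ : ∀ i, ∑ j, δ i j = ℓ i) (g : Equiv.Perm (Fin r)) :
    youngInduced ℓ h (fun i y => ((invColorings y (δ i)).card : ℂ)) g =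
      ((invColorings g fun z : Σ i, K i => δ z.1 z.2).card : ℂ) := by
  classical
  unfold youngInduced inducedClassFunction
  have h1 : ∀ x : Equiv.Perm (Fin r), (∑ y : ∀ i, Equiv.Perm (Fin (ℓ i)),
      if youngEmbedding ℓ h y = x⁻¹ * g * x then
        ∏ i, ((invColorings (y i) (δ i)).card : ℂ) else 0) =
      ((((invColorings g fun z : Σ i, K i => δ z.1 z.2).filter fun c =>
        ∀ z, (c (x ((finSigmaFinEquiv.trans (finCongr h)) z))).1 = z.1).card : ℕ) : ℂ) := by
    intro x
    rw [← sum_youngEmbedding_eq_card]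
    push_cast
    rfl
  rw [Finset.sum_congr rfl fun x _ => h1 x, ← Nat.cast_sum]
  have h2 := Finset.sum_card_bipartiteAbove_eq_sum_card_bipartiteBelow
    (s := (Finset.univ : Finset (Equiv.Perm (Fin r))))
    (t := invColorings g fun z : Σ i, K i => δ z.1 z.2)
    (fun x c => ∀ z, (c (x ((finSigmaFinEquiv.trans (finCongr h)) z))).1 = z.1)
  unfold Finset.bipartiteAbove Finset.bipartiteBelow at h2
  have h3 : ∀ c ∈ invColorings g (fun z : Σ i, K i => δ z.1 z.2),
      ∀ i, (Finset.univ.filter fun y => (c y).1 = i).card = ℓ i := by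
    intro c hc i
    rw [mem_invColorings] at hc
    zify
    rw [← hδ i, ← Finset.sum_congr rfl fun j _ => hc.2 ⟨i, j⟩, ← Nat.cast_sum,
      Nat.cast_inj, ← Finset.card_biUnion]
    · congr 1
      ext t
      simp only [Finset.mem_filter, Finset.mem_univ, true_and, Finset.mem_biUnion]
      constructor
      · rintro rfl
        exact ⟨(c t).2, rfl⟩
      · rintro ⟨j, hj⟩
        rw [hj]
    · intro a _ b _ hab
      refine Finset.disjoint_left.2 fun t ha hb => hab ?_
      simp only [Finset.mem_filter, Finset.mem_univ, true_and] at ha hb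
      rw [ha] at hb
      simpa using hb
  rw [h2, Finset.sum_congr rfl fun c hc =>
    card_perm_compatible (finSigmaFinEquiv.trans (finCongr h)) (fun y => (c y).1) (h3 c hc),
    Finset.sum_const, smul_eq_mul, Nat.cast_mul, mul_comm, mul_assoc, mul_inv_cancel₀, mul_one]
  exact Nat.cast_ne_zero.2 Fintype.card_ne_zero

theorem card_invColorings_comp {X K K' : Type*} [Fintype X] [DecidableEq X] [Fintype K]
    [DecidableEq K] [Fintype K'] [DecidableEq K'] (g : Equiv.Perm X) (γ : K → ℤ) (e : K' ≃ K) :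
    (invColorings g (γ ∘ e)).card = (invColorings g γ).card := by
  refine Finset.card_bij' (fun c _ => e ∘ c) (fun c _ => e.symm ∘ c) ?_ ?_ ?_ ?_
  · intro c hc
    rw [mem_invColorings] at hc ⊢
    refine ⟨fun x => by simp [hc.1], fun k => ?_⟩
    have := hc.2 (e.symm k)
    simpa [Equiv.eq_symm_apply] using this
  · intro c hc
    rw [mem_invColorings] at hc ⊢
    refine ⟨fun x => by simp [hc.1], fun k => ?_⟩
    have := hc.2 (e k)
    simpa [Equiv.symm_apply_eq] using this
  · intro c _
    funext x
    simp
  · intro c _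
    funext x
    simp

/-- The value of a Young permutation character counts invariant colourings. -/
theorem youngPermChar_eq_card {k : ℕ} (r : ℕ) (γ : Fin k → ℤ) (g : Equiv.Perm (Fin r)) :
    youngPermChar r γ g = ((invColorings g γ).card : ℂ) := by
  classical
  unfold youngPermChar
  split_ifs with h
  · have h1 := youngInduced_card_invColorings (fun i => (γ i).toNat) h.2 (K := fun _ => Unit)
      (fun i _ => γ i) (by intro i; simp [h.1 i]) g
    have h2 : ∀ i, (fun y : Equiv.Perm (Fin (γ i).toNat) =>
        ((invColorings y (fun _ : Unit => γ i)).card : ℂ)) = fun _ => 1 := by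
      intro i
      funext y
      rw [Nat.cast_eq_one, Finset.card_eq_one]
      refine ⟨fun _ => (), Finset.eq_singleton_iff_unique_mem.2 ⟨?_, fun c _ => rfl⟩⟩
      rw [mem_invColorings]
      refine ⟨fun _ => rfl, fun _ => ?_⟩
      simp [h.1 i]
    rw [← card_invColorings_comp g γ (Equiv.sigmaPUnit (Fin k))]
    refine Eq.trans ?_ h1
    congr 1
    funext i
    exact (h2 i).symm
  · symm
    rw [Nat.cast_eq_zero, Finset.card_eq_zero]
    refine Finset.eq_empty_of_forall_notMem fun c hc => h ?_
    rw [mem_invColorings] at hc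
    refine ⟨fun i => by rw [← hc.2]; positivity, ?_⟩
    have h1 : ∀ i, (γ i).toNat = (Finset.univ.filter fun x => c x = i).card := by
      intro i
      rw [← hc.2]
      simp
    simp only [h1]
    rw [← Finset.card_eq_sum_card_fiberwise (by intro x _; simp)]
    simp

/-! ### Alternating sums of Young permutation characters -/

/-- The value at `g` of the determinant of the matrix of trivial characters of the symmetric groups
of degrees `a i - b j`, for the induction product. -/
def altColoringSum {X K : Type*} [Fintype X] [DecidableEq X] [Fintype K] [DecidableEq K]
    (g : Equiv.Perm X) (a b : K → ℤ) : ℤ :=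
  ∑ π : Equiv.Perm K, (Equiv.Perm.sign π : ℤ) * ((invColorings g fun i => a i - b (π i)).card : ℤ)

/-- Reindexing rows and columns by different bijections multiplies by the sign of the permutation
that relates them. -/
theorem altColoringSum_eq_sign_mul {X K K' : Type*} [Fintype X] [DecidableEq X] [Fintype K]
    [DecidableEq K] [Fintype K'] [DecidableEq K'] (g : Equiv.Perm X) (a b : K → ℤ)
    (e f : K' ≃ K) :
    altColoringSum g a b =
      (Equiv.Perm.sign (e.symm.trans f) : ℤ) * altColoringSum g (a ∘ e) (b ∘ f) := by
  unfold altColoringSum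
  rw [Finset.mul_sum]
  refine (Fintype.sum_equiv
    ((e.permCongr).trans (Equiv.mulLeft (e.symm.trans f : Equiv.Perm K))) _ _ fun τ => ?_).symm
  have h1 := card_invColorings_comp g
    (fun i => a i - b ((e.permCongr.trans (Equiv.mulLeft (e.symm.trans f : Equiv.Perm K))) τ i)) e
  rw [← h1, ← mul_assoc]
  congr 2
  · simp [Equiv.Perm.sign_permCongr]
  · congr 2
    funext i
    simp

theorem altColoringSum_comp {X K K' : Type*} [Fintype X] [DecidableEq X] [Fintype K]
    [DecidableEq K] [Fintype K'] [DecidableEq K'] (g : Equiv.Perm X) (a b : K → ℤ) (e : K' ≃ K) :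
    altColoringSum g (a ∘ e) (b ∘ e) = altColoringSum g a b := by
  rw [altColoringSum_eq_sign_mul g a b e e]
  simp

theorem card_invColorings_option {X K : Type*} [Fintype X] [DecidableEq X] [Fintype K]
    [DecidableEq K] (g : Equiv.Perm X) (γ : Option K → ℤ) (h : γ none = 0) :
    (invColorings g γ).card = (invColorings g fun k => γ (some k)).card := by
  symm
  refine Finset.card_bij (fun c _ x => some (c x)) ?_ ?_ ?_
  · intro c hc
    rw [mem_invColorings] at hc ⊢
    refine ⟨fun x => by rw [hc.1], ?_⟩
    rintro (_ | k)
    · simp [h]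
    · rw [← hc.2 k]
      simp
  · intro c _ c' _ heq
    funext x
    simpa using congrFun heq x
  · intro c hc
    rw [mem_invColorings] at hc
    have h1 : ∀ x, ∃ k, some k = c x := by
      intro x
      rcases hx : c x with _ | k
      · have h2 := hc.2 none
        rw [h, Nat.cast_eq_zero, Finset.card_eq_zero] at h2
        have h3 : x ∈ Finset.univ.filter fun x => c x = none := by simp [hx]
        rw [h2] at h3
        simp at h3
      · exact ⟨k, rfl⟩
    choose c' hc' using h1
    refine ⟨c', ?_, by funext x; exact hc' x⟩
    rw [mem_invColorings]
    refine ⟨fun x => ?_, fun k => ?_⟩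
    · have := hc.1 x
      rw [← hc', ← hc'] at this
      simpa using this
    · rw [← hc.2]
      congr 3
      funext x
      rw [← hc']
      simp

/-- A row whose only non-negative entry is a `0` in the diagonal can be dropped from the
determinant. -/
theorem altColoringSum_option {X K : Type*} [Fintype X] [DecidableEq X] [Fintype K]
    [DecidableEq K] (g : Equiv.Perm X) (a b : Option K → ℤ) (h₀ : a none = b none)
    (h₁ : ∀ k, a none < b (some k)) :
    altColoringSum g a b = altColoringSum g (fun k => a (some k)) (fun k => b (some k)) := by
  unfold altColoringSum
  rw [← Fintype.sum_equiv (Equiv.Perm.decomposeOption (α := K)).symm (fun p => _) _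
    (fun p => rfl), Fintype.sum_prod_type, Fintype.sum_option]
  have hz : ∀ k (σ : Equiv.Perm K), invColorings g (fun i => a i -
      b ((Equiv.Perm.decomposeOption.symm (some k, σ) : Equiv.Perm (Option K)) i)) = ∅ := by
    intro k σ
    apply invColorings_eq_empty_of_neg g (k := none)
    have := h₁ k
    simp
    omega
  simp only [hz, Finset.card_empty, Nat.cast_zero, mul_zero, Finset.sum_const_zero, add_zero]
  refine Finset.sum_congr rfl fun σ _ => ?_
  rw [card_invColorings_option]
  · simp
  · simp [h₀]

theorem lt_colLen_of_rowLen_pos {ν : YoungDiagram} {i : ℕ} (h : 0 < ν.rowLen i) :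
    i < ν.colLen 0 := by
  rwa [← YoungDiagram.mem_iff_lt_colLen, YoungDiagram.mem_iff_lt_rowLen]

theorem rowLen_eq_zero {ν : YoungDiagram} {i : ℕ} (h : ν.colLen 0 ≤ i) : ν.rowLen i = 0 := by
  by_contra h1
  have := lt_colLen_of_rowLen_pos (Nat.pos_of_ne_zero h1)
  omega

theorem rowLen_mono {μ ν : YoungDiagram} (h : μ ≤ ν) (i : ℕ) : μ.rowLen i ≤ ν.rowLen i := by
  by_contra! hlt
  have h1 : (i, ν.rowLen i) ∈ μ := YoungDiagram.mem_iff_lt_rowLen.2 hlt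
  have h2 := YoungDiagram.mem_iff_lt_rowLen.1 (h h1)
  omega

theorem colLen_mono {μ ν : YoungDiagram} (h : μ ≤ ν) (i : ℕ) : μ.colLen i ≤ ν.colLen i := by
  by_contra! hlt
  have h1 : (ν.colLen i, i) ∈ μ := YoungDiagram.mem_iff_lt_colLen.2 hlt
  have h2 := YoungDiagram.mem_iff_lt_colLen.1 (h h1)
  omega

/-- A skew character may be computed from any number of rows that is large enough. -/
theorem skewCharacter_eq_altColoringSum_rows (s : SkewPartition) {N : ℕ}
    (hN : s.outer.colLen 0 ≤ N) (g : Equiv.Perm (Fin s.size)) :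
    skewCharacter s g = (altColoringSum g (fun i : Fin N => (s.outer.rowLen i : ℤ) - (i : ℕ))
      (fun i : Fin N => (s.inner.rowLen i : ℤ) - (i : ℕ)) : ℂ) := by
  induction N, hN using Nat.le_induction with
  | base =>
    unfold skewCharacter altColoringSum
    push_cast
    refine Finset.sum_congr rfl fun π _ => ?_
    rw [youngPermChar_eq_card]
    congr 4
    funext i
    ring
  | succ N hN ih =>
    rw [ih, Int.cast_inj, ← altColoringSum_comp g _ _ finSuccEquivLast.symm,
      altColoringSum_option]
    · congr 1 <;> funext i <;> simp
    · have h1 := rowLen_mono s.le N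
      have h2 := rowLen_eq_zero hN
      simp
      omega
    · intro i
      have h2 := rowLen_eq_zero hN
      have := i.isLt
      simp
      omega

/-- A skew character is given by the differences of bead positions. -/
theorem skewCharacter_eq_altColoringSum (s : SkewPartition) {N : ℕ}
    (hN : s.outer.colLen 0 ≤ N) (g : Equiv.Perm (Fin s.size)) :
    skewCharacter s g = (altColoringSum g (fun b : Fin N => (beadPos s.outer N b : ℤ))
      (fun b : Fin N => (beadPos s.inner N b : ℤ)) : ℂ) := by
  rw [skewCharacter_eq_altColoringSum_rows s hN, Int.cast_inj,
    ← altColoringSum_comp g (fun b : Fin N => (beadPos s.outer N b : ℤ)) _ Fin.revPerm]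
  unfold altColoringSum
  refine Finset.sum_congr rfl fun π _ => ?_
  congr 4
  funext i
  have h1 := i.isLt
  have h2 := (π i).isLt
  have h3 : N - 1 - (N - (i + 1 : ℕ)) = (i : ℕ) := by omega
  have h4 : N - 1 - (N - (π i + 1 : ℕ)) = (π i : ℕ) := by omega
  simp only [beadPos, Function.comp, Fin.revPerm_apply, Fin.val_rev, h3, h4]
  push_cast
  omega

/-! ### Invariant colourings and cycle types -/

/-- The cycles of a permutation, fixed points included, as sets of points. -/
def cycleSets {X : Type*} [Fintype X] [DecidableEq X] (g : Equiv.Perm X) : Finset (Finset X) :=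
  Finset.univ.image fun x => Finset.univ.filter fun y => g.SameCycle x y

theorem cycleSets_eq_union {X : Type*} [Fintype X] [DecidableEq X] (g : Equiv.Perm X) :
    cycleSets g = g.cycleFactorsFinset.image Equiv.Perm.support ∪ g.supportᶜ.image fun x => {x} := by
  have hmoved : ∀ x, g x ≠ x →
      (Finset.univ.filter fun y => g.SameCycle x y) = (g.cycleOf x).support := by
    intro x hx
    ext y
    simp [Equiv.Perm.mem_support_cycleOf_iff' hx]
  have hfixed : ∀ x, g x = x → (Finset.univ.filter fun y => g.SameCycle x y) = {x} := by
    intro x hx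
    ext y
    simp only [Finset.mem_filter, Finset.mem_univ, true_and, Finset.mem_singleton]
    constructor
    · rintro ⟨i, rfl⟩
      exact Equiv.Perm.zpow_apply_eq_self_of_apply_eq_self hx i
    · rintro rfl
      exact Equiv.Perm.SameCycle.refl _ _
  ext B
  simp only [cycleSets, Finset.mem_image, Finset.mem_univ, true_and, Finset.mem_union,
    Finset.mem_compl, Equiv.Perm.mem_support, not_not]
  constructor
  · rintro ⟨x, rfl⟩
    by_cases hx : g x = x
    · exact Or.inr ⟨x, hx, (hfixed x hx).symm⟩
    · exact Or.inl ⟨g.cycleOf x, Equiv.Perm.cycleOf_mem_cycleFactorsFinset_iff.2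
        (Equiv.Perm.mem_support.2 hx), (hmoved x hx).symm⟩
  · rintro (⟨σ, hσ, rfl⟩ | ⟨x, hx, rfl⟩)
    · obtain ⟨x, hx⟩ := (Equiv.Perm.mem_cycleFactorsFinset_iff.1 hσ).1.nonempty_support
      refine ⟨x, ?_⟩
      have h1 := Equiv.Perm.mem_support.1 (Equiv.Perm.mem_cycleFactorsFinset_support_le hσ hx)
      rw [hmoved x h1, Equiv.Perm.cycle_is_cycleOf hx hσ]
    · exact ⟨x, hfixed x hx⟩

/-- The cycle type of a permutation, with `1`s for the fixed points, lists the sizes of its cycles. -/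
theorem map_card_cycleSets {X : Type*} [Fintype X] [DecidableEq X] (g : Equiv.Perm X) :
    (cycleSets g).val.map Finset.card = g.partition.parts := by
  have hdisj : Disjoint (g.cycleFactorsFinset.image Equiv.Perm.support)
      (g.supportᶜ.image fun x => ({x} : Finset X)) := by
    rw [Finset.disjoint_left]
    intro B hB hB'
    simp only [Finset.mem_image] at hB hB'
    obtain ⟨σ, hσ, rfl⟩ := hB
    obtain ⟨x, _, hx⟩ := hB'
    have h1 := (Equiv.Perm.mem_cycleFactorsFinset_iff.1 hσ).1.two_le_card_support
    rw [← hx, Finset.card_singleton] at h1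
    omega
  have hinj : Set.InjOn Equiv.Perm.support (g.cycleFactorsFinset : Set (Equiv.Perm X)) := by
    intro σ hσ τ hτ h
    obtain ⟨x, hx⟩ := (Equiv.Perm.mem_cycleFactorsFinset_iff.1 hσ).1.nonempty_support
    rw [Equiv.Perm.cycle_is_cycleOf hx hσ, Equiv.Perm.cycle_is_cycleOf (h ▸ hx) hτ]
  rw [cycleSets_eq_union, ← Finset.disjUnion_eq_union _ _ hdisj, Finset.disjUnion_val,
    Multiset.map_add, Equiv.Perm.parts_partition, Finset.image_val_of_injOn hinj,
    Finset.image_val_of_injOn (Finset.singleton_injective.injOn), Multiset.map_map,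
    Multiset.map_map, Equiv.Perm.cycleType_def]
  congr 1
  simp only [Function.comp_def, Finset.card_singleton, Multiset.map_const', Finset.card_val,
    Finset.card_compl]

/-- The cycle of a point. -/
def cycleSetOf {X : Type*} [Fintype X] [DecidableEq X] (g : Equiv.Perm X) (x : X) : cycleSets g :=
  ⟨Finset.univ.filter fun y => g.SameCycle x y, Finset.mem_image_of_mem _ (Finset.mem_univ x)⟩

theorem mem_cycleSet_iff {X : Type*} [Fintype X] [DecidableEq X] (g : Equiv.Perm X) (x : X)
    (B : cycleSets g) : x ∈ B.1 ↔ cycleSetOf g x = B := by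
  obtain ⟨B, hB⟩ := B
  obtain ⟨y, -, rfl⟩ := Finset.mem_image.1 hB
  rw [Subtype.ext_iff, Finset.ext_iff]
  simp only [Finset.mem_filter, Finset.mem_univ, true_and, cycleSetOf]
  constructor
  · intro h z
    exact ⟨fun h' => h.trans h', fun h' => h.symm.trans h'⟩
  · intro h
    exact (h x).1 (Equiv.Perm.SameCycle.refl _ _)

/-- Invariant colourings are colourings of the set of cycles. -/
theorem card_invColorings_eq_card_cycleSets {X K : Type*} [Fintype X] [DecidableEq X] [Fintype K]
    [DecidableEq K] (g : Equiv.Perm X) (γ : K → ℤ) :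
    (invColorings g γ).card = (Finset.univ.filter fun c : cycleSets g → K =>
      ∀ k, ((∑ B, if c B = k then B.1.card else 0 : ℕ) : ℤ) = γ k).card := by
  have hfib : ∀ (c : cycleSets g → K) (k : K),
      (Finset.univ.filter fun x => c (cycleSetOf g x) = k).card =
        ∑ B, if c B = k then B.1.card else 0 := by
    intro c k
    rw [← Finset.sum_filter, ← Finset.card_biUnion]
    · congr 1
      ext x
      simp only [Finset.mem_filter, Finset.mem_univ, true_and, Finset.mem_biUnion,
        mem_cycleSet_iff]
      constructor
      · intro h
        exact ⟨_, h, rfl⟩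
      · rintro ⟨B, hB, rfl⟩
        exact hB
    · intro B _ B' _ hBB
      refine Finset.disjoint_left.2 fun x hx hx' => hBB ?_
      rw [mem_cycleSet_iff] at hx hx'
      rw [← hx, ← hx']
  symm
  refine Finset.card_bij (fun c _ x => c (cycleSetOf g x)) ?_ ?_ ?_
  · intro c hc
    simp only [Finset.mem_filter, Finset.mem_univ, true_and, mem_invColorings] at hc ⊢
    refine ⟨fun x => ?_, fun k => by rw [hfib, hc]⟩
    congr 1
    rw [← mem_cycleSet_iff]
    simp [cycleSetOf, Equiv.Perm.SameCycle.refl]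
  · intro c _ c' _ h
    funext ⟨B, hB⟩
    obtain ⟨x, -, rfl⟩ := Finset.mem_image.1 hB
    exact congrFun h x
  · intro c hc
    rw [mem_invColorings] at hc
    have hconst : ∀ x y, g.SameCycle x y → c x = c y := by
      intro x y hxy
      obtain ⟨i, hi, rfl⟩ := hxy.exists_pow_eq'
      clear hxy hi
      induction i with
      | zero => rfl
      | succ i ih => rw [pow_succ', Equiv.Perm.mul_apply, hc.1, ← ih]
    have hne : ∀ B : cycleSets g, ∃ x, cycleSetOf g x = B := by
      rintro ⟨B, hB⟩
      obtain ⟨x, -, rfl⟩ := Finset.mem_image.1 hB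
      exact ⟨x, rfl⟩
    choose p hp using hne
    have hcp : ∀ x, c (p (cycleSetOf g x)) = c x := by
      intro x
      refine hconst _ _ ?_
      have h1 := (mem_cycleSet_iff g x (cycleSetOf g (p (cycleSetOf g x)))).2 (hp _).symm
      exact (Finset.mem_filter.1 h1).2
    refine ⟨fun B => c (p B), ?_, funext hcp⟩
    simp only [Finset.mem_filter, Finset.mem_univ, true_and]
    intro k
    rw [← hfib, ← hc.2]
    simp only [hcp]

theorem exists_equiv_of_map_univ_eq {A B C : Type*} [Fintype A] [Fintype B] [DecidableEq C]
    (f : A → C) (f' : B → C)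
    (h : (Finset.univ : Finset A).val.map f = (Finset.univ : Finset B).val.map f') :
    ∃ e : A ≃ B, ∀ a, f' (e a) = f a := by
  classical
  have h1 : ∀ c, Fintype.card {a // f a = c} = Fintype.card {b // f' b = c} := by
    intro c
    have h2 := congrArg (Multiset.count c) h
    rw [Multiset.count_map, Multiset.count_map] at h2
    rw [Fintype.card_subtype, Fintype.card_subtype, Finset.card_def, Finset.card_def,
      Finset.filter_val, Finset.filter_val]
    simpa only [eq_comm] using h2
  refine ⟨((Equiv.sigmaFiberEquiv f).symm.trans
    (Equiv.sigmaCongrRight fun c => Fintype.equivOfCardEq (h1 c))).trans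
      (Equiv.sigmaFiberEquiv f'), fun a => ?_⟩
  exact (Fintype.equivOfCardEq (h1 (f a)) ⟨a, rfl⟩).2

/-- At an element whose cycle lengths are `n` times those of `h`, the Young permutation character
of type `n • γ` has the value of the character of type `γ` at `h`. -/
theorem card_invColorings_of_parts_eq_map_mul {X Y K : Type*} [Fintype X] [DecidableEq X]
    [Fintype Y] [DecidableEq Y] [Fintype K] [DecidableEq K] {n : ℕ} (g : Equiv.Perm X)
    (h : Equiv.Perm Y) (hgh : g.partition.parts = h.partition.parts.map fun a => n * a)
    (γ : K → ℤ) :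
    (invColorings g γ).card = (Finset.univ.filter fun c : cycleSets h → K =>
      ∀ k, (n : ℤ) * ((∑ B, if c B = k then B.1.card else 0 : ℕ) : ℤ) = γ k).card := by
  rw [← map_card_cycleSets, ← map_card_cycleSets, Multiset.map_map] at hgh
  obtain ⟨e, he⟩ := exists_equiv_of_map_univ_eq (A := cycleSets g) (B := cycleSets h)
    (fun B => B.1.card) (fun B => n * B.1.card)
    ((Multiset.attach_map_val' (cycleSets g).val Finset.card).trans (hgh.trans
      (Multiset.attach_map_val' (cycleSets h).val fun B => n * B.card).symm))
  rw [card_invColorings_eq_card_cycleSets]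
  have hsum : ∀ (c : cycleSets h → K) (k : K), ((∑ B : cycleSets g, if c (e B) = k then
      B.1.card else 0 : ℕ) : ℤ) = n * ((∑ B, if c B = k then B.1.card else 0 : ℕ) : ℤ) := by
    intro c k
    rw [← Nat.cast_mul, Nat.cast_inj, Finset.mul_sum]
    refine Fintype.sum_equiv e _ _ fun B => ?_
    rw [mul_ite, mul_zero, he]
  refine Finset.card_bij' (fun c _ => c ∘ e.symm) (fun c _ => c ∘ e) ?_ ?_ ?_ ?_
  · intro c hc
    simp only [Finset.mem_filter, Finset.mem_univ, true_and] at hc ⊢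
    intro k
    rw [← hc, ← hsum]
    simp
  · intro c hc
    simp only [Finset.mem_filter, Finset.mem_univ, true_and] at hc ⊢
    intro k
    rw [← hc, ← hsum]
    rfl
  · intro c _
    funext x
    simp
  · intro c _
    funext x
    simp

theorem card_invColorings_mul {X Y K : Type*} [Fintype X] [DecidableEq X]
    [Fintype Y] [DecidableEq Y] [Fintype K] [DecidableEq K] {n : ℕ} (hn : 0 < n)
    (g : Equiv.Perm X) (h : Equiv.Perm Y)
    (hgh : g.partition.parts = h.partition.parts.map fun a => n * a) (γ : K → ℤ) :
    (invColorings g fun k => n * γ k).card = (invColorings h γ).card := by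
  rw [card_invColorings_of_parts_eq_map_mul g h hgh, card_invColorings_eq_card_cycleSets]
  have hn' : (n : ℤ) ≠ 0 := by exact_mod_cast hn.ne'
  simp only [mul_right_inj' hn']

theorem invColorings_eq_empty_of_not_dvd {X Y K : Type*} [Fintype X] [DecidableEq X]
    [Fintype Y] [DecidableEq Y] [Fintype K] [DecidableEq K] {n : ℕ}
    (g : Equiv.Perm X) (h : Equiv.Perm Y)
    (hgh : g.partition.parts = h.partition.parts.map fun a => n * a) {γ : K → ℤ} {k : K}
    (hk : ¬ (n : ℤ) ∣ γ k) : invColorings g γ = ∅ := by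
  rw [← Finset.card_eq_zero, card_invColorings_of_parts_eq_map_mul g h hgh, Finset.card_eq_zero]
  refine Finset.eq_empty_of_forall_notMem fun c hc => hk ?_
  rw [← (Finset.mem_filter.1 hc).2 k]
  exact dvd_mul_right _ _

/-! ### Bead sets -/

/-- The positions of the beads in the abacus display of `ν` with `N` beads. -/
def beadSet (ν : YoungDiagram) (N : ℕ) : Finset ℕ := Finset.univ.image (beadPos ν N)

/-- The number of beads at positions `≥ q`. -/
def beadsFrom (X : Finset ℕ) (q : ℕ) : ℕ := (X.filter fun x => q ≤ x).card

/-- The number of beads at positions `≥ q` on the runner of `q`, on an `n`-runner abacus. -/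
def runnerBeadsFrom (n : ℕ) (X : Finset ℕ) (q : ℕ) : ℕ :=
  (X.filter fun x => q ≤ x ∧ x % n = q % n).card

theorem card_beadSet (ν : YoungDiagram) (N : ℕ) : (beadSet ν N).card = N := by
  rw [beadSet, Finset.card_image_of_injective _ (beadPos_strictMono ν N).injective,
    Finset.card_fin]

theorem beadsFrom_le_card (X : Finset ℕ) (q : ℕ) : beadsFrom X q ≤ X.card :=
  Finset.card_filter_le _ _

theorem card_le_beadsFrom_add (X : Finset ℕ) (q : ℕ) : X.card ≤ beadsFrom X q + q := by
  have h1 := Finset.card_filter_add_card_filter_not (s := X) (fun x => q ≤ x)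
  have h2 : (X.filter fun x => ¬ q ≤ x).card ≤ (Finset.range q).card := by
    refine Finset.card_le_card fun x hx => ?_
    simp only [Finset.mem_filter, not_le] at hx
    exact Finset.mem_range.2 hx.2
  rw [Finset.card_range] at h2
  unfold beadsFrom
  omega

theorem beadsFrom_eq_add (X : Finset ℕ) (q : ℕ) :
    beadsFrom X q = beadsFrom X (q + 1) + if q ∈ X then 1 else 0 := by
  unfold beadsFrom
  have h : (X.filter fun x => q ≤ x) =
      (X.filter fun x => q + 1 ≤ x) ∪ X.filter fun x => x = q := by
    rw [← Finset.filter_or]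
    refine Finset.filter_congr fun x _ => ?_
    omega
  rw [h, Finset.card_union_of_disjoint, Finset.filter_eq']
  · split_ifs <;> simp
  · exact Finset.disjoint_filter.2 fun x _ h1 h2 => by omega

theorem runnerBeadsFrom_eq_add {n : ℕ} (hn : 0 < n) (X : Finset ℕ) (q : ℕ) :
    runnerBeadsFrom n X q = runnerBeadsFrom n X (q + n) + if q ∈ X then 1 else 0 := by
  unfold runnerBeadsFrom
  have h : (X.filter fun x => q ≤ x ∧ x % n = q % n) =
      (X.filter fun x => q + n ≤ x ∧ x % n = (q + n) % n) ∪ X.filter fun x => x = q := by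
    rw [← Finset.filter_or]
    refine Finset.filter_congr fun x _ => ?_
    rw [Nat.add_mod_right]
    constructor
    · rintro ⟨h1, h2⟩
      by_cases h3 : q + n ≤ x
      · exact Or.inl ⟨h3, h2⟩
      · have h4 := Nat.eq_zero_of_dvd_of_lt ((Nat.modEq_iff_dvd' h1).1 h2.symm) (by omega)
        omega
    · rintro (⟨h1, h2⟩ | rfl)
      · exact ⟨by omega, h2⟩
      · exact ⟨le_rfl, rfl⟩
  rw [h, Finset.card_union_of_disjoint, Finset.filter_eq']
  · split_ifs <;> simp
  · exact Finset.disjoint_filter.2 fun x _ h1 h2 => by omega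

/-- The cells of the diagram of `ν` on the diagonal of content `d` are counted by the beads at
positions `≥ N + d`. -/
theorem mem_iff_lt_beadsFrom {ν : YoungDiagram} {N : ℕ} (hN : ν.colLen 0 ≤ N) (i j : ℕ) :
    (i, j) ∈ ν ↔ i < beadsFrom (beadSet ν N) (j + N - i) := by
  have hF : ∀ q, beadsFrom (beadSet ν N) q =
      (Finset.univ.filter fun b : Fin N => q ≤ beadPos ν N b).card := by
    intro q
    rw [beadsFrom, beadSet, Finset.filter_image,
      Finset.card_image_of_injective _ (beadPos_strictMono ν N).injective]
  rw [YoungDiagram.mem_iff_lt_rowLen]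
  rcases le_or_gt N i with hi | hi
  · have h1 := beadsFrom_le_card (beadSet ν N) (j + N - i)
    rw [card_beadSet] at h1
    rw [rowLen_eq_zero (hN.trans hi)]
    omega
  · have hb : N - 1 - (N - 1 - i) = i := by omega
    let b₀ : Fin N := ⟨N - 1 - i, by omega⟩
    have hb₀ : beadPos ν N b₀ = ν.rowLen i + (N - 1 - i) := by simp [beadPos, b₀, hb]
    rw [hF]
    constructor
    · intro hj
      have h1 : Finset.Ici b₀ ⊆ Finset.univ.filter fun b : Fin N => j + N - i ≤ beadPos ν N b := by
        intro b h2
        have h3 := (beadPos_strictMono ν N).monotone (Finset.mem_Ici.1 h2)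
        simp only [Finset.mem_filter, Finset.mem_univ, true_and]
        omega
      have h2 := Finset.card_le_card h1
      rw [Fin.card_Ici] at h2
      simp only [b₀] at h2
      omega
    · intro hj
      by_contra h0
      have h1 : (Finset.univ.filter fun b : Fin N => j + N - i ≤ beadPos ν N b) ⊆
          Finset.Ioi b₀ := by
        intro b h2
        simp only [Finset.mem_filter, Finset.mem_univ, true_and] at h2
        rw [Finset.mem_Ioi]
        by_contra h3
        have h4 := (beadPos_strictMono ν N).monotone (not_lt.1 h3)
        omega
      have h2 := Finset.card_le_card h1
      rw [Fin.card_Ioi] at h2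
      simp only [b₀] at h2
      omega

/-- A cell of `ν`, named by its row `i` and its diagonal. -/
theorem mem_diagonal_iff {ν : YoungDiagram} {N : ℕ} (hN : ν.colLen 0 ≤ N) {i q : ℕ}
    (h : N ≤ q + i) : (i, q + i - N) ∈ ν ↔ i < beadsFrom (beadSet ν N) q := by
  rw [mem_iff_lt_beadsFrom hN]
  congr! 2
  omega

theorem lt_of_mem_of_colLen_le {ν : YoungDiagram} {N : ℕ} (hN : ν.colLen 0 ≤ N) {c : ℕ × ℕ}
    (hc : c ∈ ν) : c.1 < N := by
  have h1 := (mem_iff_lt_beadsFrom hN c.1 c.2).1 hc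
  have h2 := beadsFrom_le_card (beadSet ν N) (c.2 + N - c.1)
  rw [card_beadSet] at h2
  omega

theorem le_iff_beadsFrom_le {μ ν : YoungDiagram} {N : ℕ} (hμ : μ.colLen 0 ≤ N)
    (hν : ν.colLen 0 ≤ N) :
    μ ≤ ν ↔ ∀ q, beadsFrom (beadSet μ N) q ≤ beadsFrom (beadSet ν N) q := by
  constructor
  · intro h q
    by_contra! hlt
    have h1 := card_le_beadsFrom_add (beadSet ν N) q
    rw [card_beadSet] at h1
    have h2 := h ((mem_diagonal_iff hμ (by omega)).2 hlt)
    have h3 := (mem_diagonal_iff hν (by omega)).1 h2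
    omega
  · rintro h ⟨i, j⟩ hc
    have h1 := (mem_iff_lt_beadsFrom hμ i j).1 hc
    exact (mem_iff_lt_beadsFrom hν i j).2 (h1.trans_le (h _))

theorem eq_of_beadSet_eq {μ ν : YoungDiagram} {N : ℕ} (hμ : μ.colLen 0 ≤ N)
    (hν : ν.colLen 0 ≤ N) (h : beadSet μ N = beadSet ν N) : μ = ν :=
  le_antisymm ((le_iff_beadsFrom_le hμ hν).2 fun q => by rw [h])
    ((le_iff_beadsFrom_le hν hμ).2 fun q => by rw [h])

theorem card_eq_sum_rowLen {ν : YoungDiagram} {N : ℕ} (hN : ν.colLen 0 ≤ N) :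
    ν.card = ∑ i ∈ Finset.range N, ν.rowLen i := by
  rw [YoungDiagram.card, Finset.card_eq_sum_card_fiberwise (f := Prod.fst) (t := Finset.range N)]
  · refine Finset.sum_congr rfl fun i _ => ?_
    rw [YoungDiagram.rowLen_eq_card]
    rfl
  · intro c hc
    exact Finset.mem_coe.2 (Finset.mem_range.2 (lt_of_mem_of_colLen_le hN hc))

theorem sum_beadSet {ν : YoungDiagram} {N : ℕ} (hN : ν.colLen 0 ≤ N) :
    ∑ x ∈ beadSet ν N, x = ν.card + ∑ i ∈ Finset.range N, i := by
  rw [beadSet, Finset.sum_image fun a _ b _ h => (beadPos_strictMono ν N).injective h,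
    card_eq_sum_rowLen hN]
  simp only [beadPos]
  rw [Finset.sum_add_distrib, Fin.sum_univ_eq_sum_range (fun b => ν.rowLen (N - 1 - b)),
    Fin.sum_univ_eq_sum_range (fun b => b), Finset.sum_range_reflect]

/-! ### The partition of a bead set -/

/-- The bead numbered `l` has `l` beads before it, and all other earlier positions are gaps. -/
theorem gapsBefore_add {c : ℕ} (f : Fin c → ℕ) (hf : StrictMono f) (l : Fin c) :
    gapsBefore (Finset.univ.image f) (f l) + l = f l := by
  have h1 := Finset.card_filter_add_card_filter_not (s := Finset.range (f l))
    (fun x => x ∉ Finset.univ.image f)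
  have h2 : ((Finset.range (f l)).filter fun x => ¬ x ∉ Finset.univ.image f) =
      (Finset.Iio l).image f := by
    ext x
    simp only [Finset.mem_filter, Finset.mem_range, not_not, Finset.mem_image, Finset.mem_univ,
      true_and, Finset.mem_Iio]
    constructor
    · rintro ⟨hx, a, rfl⟩
      exact ⟨a, hf.lt_iff_lt.1 hx, rfl⟩
    · rintro ⟨a, ha, rfl⟩
      exact ⟨hf ha, a, rfl⟩
  rw [h2, Finset.card_image_of_injective _ hf.injective, Fin.card_Iio, Finset.card_range] at h1
  exact h1

theorem colLen_partitionOfBeads_le (X : Finset ℕ) : (partitionOfBeads X).colLen 0 ≤ X.card := by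
  by_contra! h
  have h1 := YoungDiagram.mem_iff_lt_colLen.2 h
  rw [partitionOfBeads, YoungDiagram.mem_ofRowLens] at h1
  obtain ⟨h1, -⟩ := h1
  simp at h1

/-- The partition of a bead set has this set as its bead set. -/
theorem beadSet_partitionOfBeads {X : Finset ℕ} {c : ℕ} (hc : X.card = c) :
    beadSet (partitionOfBeads X) c = X := by
  have hlen : (X.sort (· ≥ ·)).length = c := by rw [Finset.length_sort, hc]
  let f : Fin c → ℕ := fun l => (X.sort (· ≥ ·))[c - 1 - (l : ℕ)]'(by have := l.isLt; omega)
  have hf : StrictMono f := by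
    intro a b hab
    refine List.pairwise_iff_getElem.1 (X.sortedGT_sort).pairwise _ _ _ _ ?_
    have h1 : (a : ℕ) < b := hab
    have := b.isLt
    omega
  have hX : Finset.univ.image f = X := by
    refine Finset.eq_of_subset_of_card_le ?_ ?_
    · intro x hx
      obtain ⟨l, -, rfl⟩ := Finset.mem_image.1 hx
      exact (Finset.mem_sort _).1 (List.getElem_mem _)
    · rw [Finset.card_image_of_injective _ hf.injective, Finset.card_fin, hc]
  have h1 : beadPos (partitionOfBeads X) c = f := by
    funext l
    have h2 := gapsBefore_add f hf l
    rw [hX] at h2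
    rw [beadPos, ← h2]
    congr 1
    have := l.isLt
    exact YoungDiagram.rowLen_ofRowLens
      (⟨c - 1 - l, by rw [List.length_map]; omega⟩ : Fin ((X.sort (· ≥ ·)).map _).length)
      |>.trans (List.getElem_map _)
  rw [beadSet, h1, hX]

/-! ### Moving a bead -/

theorem beadsFrom_eq_sum (X : Finset ℕ) (q : ℕ) :
    beadsFrom X q = ∑ x ∈ X, if q ≤ x then 1 else 0 := by
  rw [beadsFrom, Finset.card_filter]

theorem sum_insert_erase {M : Type*} [AddCommMonoid M] {X : Finset ℕ} {p p' : ℕ} (hp : p ∈ X)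
    (hp' : p' ∉ X) (f : ℕ → M) :
    (∑ x ∈ insert p' (X.erase p), f x) + f p = (∑ x ∈ X, f x) + f p' := by
  rw [Finset.sum_insert fun h => hp' (Finset.mem_of_mem_erase h), add_assoc,
    Finset.sum_erase_add _ _ hp, add_comm]

theorem beadsFrom_move {X : Finset ℕ} {p n : ℕ} (hp : p + n ∈ X) (hp' : p ∉ X) (q : ℕ) :
    beadsFrom X q = beadsFrom (insert p (X.erase (p + n))) q +
      if p < q ∧ q ≤ p + n then 1 else 0 := by
  have h := sum_insert_erase hp hp' (fun x => if q ≤ x then 1 else 0)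
  rw [beadsFrom_eq_sum, beadsFrom_eq_sum]
  split_ifs at h ⊢ <;> omega

theorem runnerBeadsFrom_move {X : Finset ℕ} {p n : ℕ} (hn : 0 < n) (hp : p + n ∈ X) (hp' : p ∉ X)
    (q : ℕ) : runnerBeadsFrom n X q = runnerBeadsFrom n (insert p (X.erase (p + n))) q +
      if q = p + n then 1 else 0 := by
  have h := sum_insert_erase hp hp' (fun x => if q ≤ x ∧ x % n = q % n then 1 else 0)
  rw [runnerBeadsFrom, runnerBeadsFrom, Finset.card_filter, Finset.card_filter]
  have h2 : (p + n) % n = p % n := Nat.add_mod_right p n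
  rw [h2] at h
  by_cases hq : q ≤ p + n ∧ p % n = q % n
  · by_cases hqp : q ≤ p
    · have : q ≠ p + n := by omega
      simp only [hq.1, hq.2, hqp, this, and_true, if_true, if_false] at h ⊢
      omega
    · -- the two positions differ by less than `n` and lie on one runner
      have : q = p + n := by
        have h3 : (p + n) ≡ q [MOD n] := by rw [Nat.ModEq, h2, hq.2]
        have h4 := (Nat.modEq_iff_dvd' hq.1).1 h3.symm
        have h5 := Nat.eq_zero_of_dvd_of_lt h4 (by omega)
        omega
      simp only [this, h2] at h ⊢
      simp only [le_refl, and_self, if_true] at h ⊢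
      have : ¬ (p + n ≤ p ∧ True) := by omega
      simp only [this, if_false] at h
      omega
  · have h3 : ¬ (q ≤ p ∧ p % n = q % n) := fun h3 => hq ⟨by omega, h3.2⟩
    have h4 : q ≠ p + n := fun h4 => hq ⟨by omega, by rw [h4, h2]⟩
    simp only [hq, h3, h4, if_false] at h ⊢
    omega

/-- If a set of beads has one bead more than another one beyond exactly the positions in
`(p, p + n]`, then the latter arises from the former by moving a bead from `p + n` to `p`. -/
theorem eq_move_of_beadsFrom {X Y : Finset ℕ} {p n : ℕ} (hn : 0 < n)
    (h : ∀ q, beadsFrom X q = beadsFrom Y q + if p < q ∧ q ≤ p + n then 1 else 0) :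
    p + n ∈ X ∧ p ∉ X ∧ Y = insert p (X.erase (p + n)) := by
  have key : ∀ x, (if x ∈ X then 1 else 0) + (if p < x + 1 ∧ x + 1 ≤ p + n then 1 else 0) =
      (if x ∈ Y then 1 else 0) + (if p < x ∧ x ≤ p + n then 1 else 0) := by
    intro x
    have h1 := h x
    have h2 := h (x + 1)
    rw [beadsFrom_eq_add X, beadsFrom_eq_add Y] at h1
    omega
  refine ⟨?_, ?_, ?_⟩
  · have := key (p + n)
    split_ifs at this <;> first | assumption | omega
  · have := key p
    split_ifs at this <;> first | assumption | omega
  · ext x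
    have := key x
    rw [Finset.mem_insert, Finset.mem_erase]
    have h1 := key p
    split_ifs at this <;> grind

/-! ### Border strips and bead moves -/

theorem mem_cells_iff {s : SkewPartition} {c : ℕ × ℕ} :
    c ∈ s.cells ↔ c ∈ s.outer ∧ c ∉ s.inner := by
  simp [SkewPartition.cells]

theorem size_add_card_inner (s : SkewPartition) : s.size + s.inner.card = s.outer.card :=
  Finset.card_sdiff_add_card_eq_card (YoungDiagram.cells_subset_iff.2 s.le)

theorem hasse_boxProd_adj_iff {c d : ℕ × ℕ} : (SimpleGraph.hasse ℕ □ SimpleGraph.hasse ℕ).Adj c d ↔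
    ((c.1 + 1 = d.1 ∨ d.1 + 1 = c.1) ∧ c.2 = d.2) ∨
      ((c.2 + 1 = d.2 ∨ d.2 + 1 = c.2) ∧ c.1 = d.1) := by
  rw [SimpleGraph.boxProd_adj, SimpleGraph.hasse_adj, SimpleGraph.hasse_adj]
  simp only [Nat.covBy_iff_add_one_eq]

/-- In a skew diagram without `2 × 2` squares each diagonal has at most one cell. -/
theorem eq_of_same_diagonal {s : SkewPartition} (h : ¬ ∃ i j : ℕ, (i, j) ∈ s.cells ∧
    (i, j + 1) ∈ s.cells ∧ (i + 1, j) ∈ s.cells ∧ (i + 1, j + 1) ∈ s.cells) {c d : ℕ × ℕ}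
    (hc : c ∈ s.cells) (hd : d ∈ s.cells) (hcd : c.2 + d.1 = d.2 + c.1) : c = d := by
  have key : ∀ c d : ℕ × ℕ, c ∈ s.cells → d ∈ s.cells → c.2 + d.1 = d.2 + c.1 → ¬ c.1 < d.1 := by
    rintro ⟨i, j⟩ ⟨i', j'⟩ hc hd hcd hlt
    simp only at hcd hlt
    rw [mem_cells_iff] at hc hd
    refine h ⟨i, j, ?_⟩
    simp only [mem_cells_iff]
    exact ⟨hc, ⟨s.outer.up_left_mem (by omega) (by omega) hd.1,
        fun h' => hc.2 (s.inner.up_left_mem (by omega) (by omega) h')⟩,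
      ⟨s.outer.up_left_mem (by omega) (by omega) hd.1,
        fun h' => hc.2 (s.inner.up_left_mem (by omega) (by omega) h')⟩,
      ⟨s.outer.up_left_mem (by omega) (by omega) hd.1,
        fun h' => hc.2 (s.inner.up_left_mem (by omega) (by omega) h')⟩⟩
  have h1 := key c d hc hd hcd
  have h2 := key d c hd hc hcd.symm
  ext <;> omega

/-- A finite set of natural numbers with no gaps is an interval. -/
theorem exists_eq_Ioc {D : Finset ℕ} (hD : D.Nonempty) (h0 : 0 ∉ D)
    (h : ∀ a ∈ D, ∀ b ∈ D, ∀ c, a < c → c < b → c ∈ D) :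
    ∃ p, D = Finset.Ioc p (p + D.card) := by
  have h1 : D = Finset.Icc (D.min' hD) (D.max' hD) := by
    ext c
    rw [Finset.mem_Icc]
    constructor
    · exact fun hc => ⟨D.min'_le c hc, D.le_max' c hc⟩
    · rintro ⟨h2, h3⟩
      rcases h2.eq_or_lt with h2 | h2
      · exact h2 ▸ D.min'_mem hD
      rcases h3.eq_or_lt with h3 | h3
      · exact h3 ▸ D.max'_mem hD
      exact h _ (D.min'_mem hD) _ (D.max'_mem hD) c h2 h3
  have h2 : D.min' hD ≠ 0 := fun h2 => h0 (h2 ▸ D.min'_mem hD)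
  have h3 : D.min' hD ≤ D.max' hD := D.min'_le _ (D.max'_mem hD)
  have h4 : D.card = D.max' hD + 1 - D.min' hD := by
    conv_lhs => rw [h1]
    exact Nat.card_Icc _ _
  refine ⟨D.min' hD - 1, ?_⟩
  rw [h4]
  conv_lhs => rw [h1]
  ext c
  rw [Finset.mem_Icc, Finset.mem_Ioc]
  omega

/-- A border strip has exactly one cell in each of an interval of consecutive diagonals. -/
theorem exists_beadsFrom_of_isBorderStrip {s : SkewPartition} {N : ℕ} (hN : s.outer.colLen 0 ≤ N)
    (hs : s.IsBorderStrip) :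
    ∃ p, ∀ q, beadsFrom (beadSet s.outer N) q = beadsFrom (beadSet s.inner N) q +
      if p < q ∧ q ≤ p + s.size then 1 else 0 := by
  have hN' : s.inner.colLen 0 ≤ N := (colLen_mono s.le 0).trans hN
  obtain ⟨hconn, hsq⟩ := hs
  have hlt : ∀ c ∈ s.cells, c.1 < N := fun c hc =>
    lt_of_mem_of_colLen_le hN (mem_cells_iff.1 hc).1
  set diag : ℕ × ℕ → ℕ := fun c => c.2 + N - c.1 with hdiag
  have hinj : ∀ c ∈ s.cells, ∀ d ∈ s.cells, diag c = diag d → c = d := by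
    intro c hc d hd h
    have h1 := hlt c hc
    have h2 := hlt d hd
    simp only [hdiag] at h
    exact eq_of_same_diagonal hsq hc hd (by omega)
  have hcard : (s.cells.image diag).card = s.size :=
    Finset.card_image_of_injOn fun c hc d hd h => hinj c hc d hd h
  obtain ⟨p, hp⟩ : ∃ p, s.cells.image diag = Finset.Ioc p (p + (s.cells.image diag).card) := by
    apply exists_eq_Ioc
    · obtain ⟨⟨c, hc⟩⟩ := hconn.nonempty
      exact ⟨diag c, Finset.mem_image_of_mem _ hc⟩
    · intro h0
      obtain ⟨c, hc, h0⟩ := Finset.mem_image.1 h0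
      have := hlt c hc
      simp only [hdiag] at h0
      omega
    · intro a ha b hb q haq hqb
      obtain ⟨c, hc, rfl⟩ := Finset.mem_image.1 ha
      obtain ⟨d, hd, rfl⟩ := Finset.mem_image.1 hb
      by_contra hq
      -- a step to an adjacent cell changes the diagonal by one, so cannot jump over `q`
      have hstep : ∀ u v : (s.cells : Set (ℕ × ℕ)),
          ((SimpleGraph.hasse ℕ □ SimpleGraph.hasse ℕ).induce (s.cells : Set (ℕ × ℕ))).Walk u v →
          diag u.1 < q → diag v.1 < q := by
        intro u v w
        induction w with
        | nil => exact id
        | @cons u v w huv _ ih =>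
          intro hu
          refine ih ?_
          have h1 := hasse_boxProd_adj_iff.1 (SimpleGraph.induce_adj.1 huv)
          have h2 := hlt u.1 u.2
          have h3 := hlt v.1 v.2
          have h4 : diag v.1 ≠ q := fun h => hq (h ▸ Finset.mem_image_of_mem _ v.2)
          simp only [hdiag] at hu h4 ⊢
          omega
      obtain ⟨w⟩ := hconn.preconnected ⟨c, hc⟩ ⟨d, hd⟩
      have := hstep _ _ w haq
      simp only at this
      omega
  rw [hcard] at hp
  refine ⟨p, fun q => ?_⟩
  have hle := (le_iff_beadsFrom_le hN' hN).1 s.le q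
  have hsmall := card_le_beadsFrom_add (beadSet s.inner N) q
  rw [card_beadSet] at hsmall
  have hmem : ∀ i, beadsFrom (beadSet s.inner N) q ≤ i → i < beadsFrom (beadSet s.outer N) q →
      (i, q + i - N) ∈ s.cells := by
    intro i h1 h2
    rw [mem_cells_iff, mem_diagonal_iff hN (by omega), mem_diagonal_iff hN' (by omega)]
    omega
  have hbig := beadsFrom_le_card (beadSet s.outer N) q
  rw [card_beadSet] at hbig
  have hq : (p < q ∧ q ≤ p + s.size) ↔ ∃ c ∈ s.cells, diag c = q := by
    rw [← Finset.mem_Ioc, ← hp, Finset.mem_image]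
  split_ifs with h
  · obtain ⟨c, hc, hcq⟩ := hq.1 h
    have h1 := (mem_iff_lt_beadsFrom hN c.1 c.2).1 (mem_cells_iff.1 hc).1
    have h2 : ¬ c.1 < beadsFrom (beadSet s.inner N) (c.2 + N - c.1) := fun h =>
      (mem_cells_iff.1 hc).2 ((mem_iff_lt_beadsFrom hN' c.1 c.2).2 h)
    have hcq' : c.2 + N - c.1 = q := hcq
    rw [hcq'] at h1 h2
    by_contra h3
    have h4 := hinj _ (hmem (beadsFrom (beadSet s.inner N) q) le_rfl (by omega)) _
      (hmem (beadsFrom (beadSet s.inner N) q + 1) (by omega) (by omega))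
      (by simp only [hdiag]; omega)
    simp at h4
  · by_contra h3
    refine h (hq.2 ⟨_, hmem (beadsFrom (beadSet s.inner N) q) le_rfl (by omega), ?_⟩)
    simp only [hdiag]
    omega

/-- Conversely, one cell in each of `n` consecutive diagonals makes a border strip: its cells form
a path. -/
theorem isBorderStrip_of_beadsFrom {s : SkewPartition} {N n p : ℕ} (hn : 0 < n)
    (hN : s.outer.colLen 0 ≤ N)
    (h : ∀ q, beadsFrom (beadSet s.outer N) q = beadsFrom (beadSet s.inner N) q +
      if p < q ∧ q ≤ p + n then 1 else 0) :
    s.IsBorderStrip ∧ s.size = n := by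
  have hN' : s.inner.colLen 0 ≤ N := (colLen_mono s.le 0).trans hN
  set F := beadsFrom (beadSet s.inner N) with hF
  have hsmall : ∀ q, N ≤ F q + q := fun q => by
    have := card_le_beadsFrom_add (beadSet s.inner N) q
    rwa [card_beadSet] at this
  have hbig : ∀ q, F q ≤ N := fun q => by
    have := beadsFrom_le_card (beadSet s.inner N) q
    rwa [card_beadSet] at this
  let cell : ℕ → ℕ × ℕ := fun q => (F q, q + F q - N)
  have hcell : ∀ q, (cell q).2 + N - (cell q).1 = q := fun q => by
    have := hsmall q
    have := hbig q
    simp only [cell]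
    omega
  have hcells : s.cells = (Finset.Ioc p (p + n)).image cell := by
    ext ⟨i, j⟩
    rw [mem_cells_iff, Finset.mem_image]
    constructor
    · rintro ⟨h1, h2⟩
      have h3 := lt_of_mem_of_colLen_le hN h1
      rw [mem_iff_lt_beadsFrom hN, h] at h1
      rw [mem_iff_lt_beadsFrom hN', ← hF] at h2
      simp only at h3
      refine ⟨j + N - i, ?_, ?_⟩
      · rw [Finset.mem_Ioc]
        by_contra h4
        rw [if_neg h4] at h1
        omega
      · have h4 : F (j + N - i) = i := by
          split_ifs at h1 <;> omega
        simp only [cell, h4, Prod.mk.injEq, true_and]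
        omega
    · rintro ⟨q, hq, heq⟩
      rw [Finset.mem_Ioc] at hq
      have h1 := hsmall q
      simp only [cell, Prod.mk.injEq] at heq
      obtain ⟨rfl, rfl⟩ := heq
      rw [mem_diagonal_iff hN (by omega), mem_diagonal_iff hN' (by omega), h, if_pos hq, ← hF]
      omega
  have hinj : Function.Injective cell := fun q q' hqq => by
    rw [← hcell q, ← hcell q', hqq]
  have hmem : ∀ q, p < q → q ≤ p + n → cell q ∈ s.cells := fun q h1 h2 => by
    rw [hcells]
    exact Finset.mem_image_of_mem _ (Finset.mem_Ioc.2 ⟨h1, h2⟩)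
  refine ⟨⟨?_, ?_⟩, ?_⟩
  · have hreach : ∀ k (hk : k < n),
        ((SimpleGraph.hasse ℕ □ SimpleGraph.hasse ℕ).induce (s.cells : Set (ℕ × ℕ))).Reachable
          ⟨cell (p + 1), hmem _ (by omega) (by omega)⟩
          ⟨cell (p + 1 + k), hmem _ (by omega) (by omega)⟩ := by
      intro k
      induction k with
      | zero => exact fun _ => SimpleGraph.Reachable.refl _
      | succ k ih =>
        intro hk
        refine (ih (by omega)).trans (SimpleGraph.Adj.reachable ?_)
        rw [SimpleGraph.induce_adj, hasse_boxProd_adj_iff]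
        have h1 := beadsFrom_eq_add (beadSet s.inner N) (p + 1 + k)
        rw [← hF] at h1
        have h2 := hsmall (p + 1 + k)
        have h3 := hsmall (p + 1 + k + 1)
        simp only [cell, ← add_assoc]
        split_ifs at h1
        · left
          omega
        · right
          omega
    have hall : ∀ c (hc : c ∈ s.cells), ∃ k, ∃ hk : k < n, c = cell (p + 1 + k) := by
      intro c hc
      rw [hcells] at hc
      obtain ⟨q, hq, rfl⟩ := Finset.mem_image.1 hc
      rw [Finset.mem_Ioc] at hq
      exact ⟨q - (p + 1), by omega, by congr 1; omega⟩
    have : Nonempty (s.cells : Set (ℕ × ℕ)) := ⟨⟨_, hmem (p + 1) (by omega) (by omega)⟩⟩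
    refine SimpleGraph.Connected.mk fun u v => ?_
    obtain ⟨u, hu⟩ := u
    obtain ⟨v, hv⟩ := v
    obtain ⟨k, hk, rfl⟩ := hall u hu
    obtain ⟨k', hk', rfl⟩ := hall v hv
    exact (hreach k hk).symm.trans (hreach k' hk')
  · rintro ⟨i, j, h1, -, -, h2⟩
    rw [hcells] at h1 h2
    obtain ⟨q, -, h1⟩ := Finset.mem_image.1 h1
    obtain ⟨q', -, h2⟩ := Finset.mem_image.1 h2
    have h3 := hcell q
    have h4 := hcell q'
    rw [h1] at h3
    rw [h2] at h4
    obtain rfl : q = q' := by simp only at h3 h4; omega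
    rw [h1] at h2
    simp at h2
  · rw [SkewPartition.size, hcells, Finset.card_image_of_injective _ hinj, Nat.card_Ioc]
    omega

/-! ### Decomposability and dominance of bead sets -/

theorem isDecomposable_zero {s : SkewPartition} {n : ℕ} :
    s.IsDecomposable 0 n ↔ s.size = 0 := by
  constructor
  · rintro ⟨T, -⟩
    refine Finset.card_eq_zero.2 (Finset.eq_empty_of_forall_notMem fun c hc => ?_)
    exact (T ⟨c, hc⟩).elim0
  · intro h
    have h1 := Finset.card_eq_zero.1 h
    have h2 : ∀ c : s.cells, False := by
      rintro ⟨c, hc⟩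
      rw [h1] at hc
      simp at hc
    exact ⟨fun c => (h2 c).elim, fun c => (h2 c).elim, fun c => (h2 c).elim, fun j => j.elim0⟩

/-- The cells that carry the last label of a tableau form a border strip at the outer rim, and
removing them leaves a shape that is decomposable into one strip less. -/
theorem SkewChar.SkewPartition.IsDecomposable.exists_of_succ {s : SkewPartition} {m n : ℕ}
    (hs : s.IsDecomposable (m + 1) n) :
    ∃ (κ : YoungDiagram) (h₁ : s.inner ≤ κ) (h₂ : κ ≤ s.outer),
      SkewPartition.IsBorderStrip ⟨s.outer, κ, h₂⟩ ∧ SkewPartition.size ⟨s.outer, κ, h₂⟩ = n ∧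
      SkewPartition.IsDecomposable ⟨κ, s.inner, h₁⟩ m n := by
  obtain ⟨T, hrow, hcol, hstrip⟩ := hs
  have hmono : ∀ a b : s.cells, a.1.1 ≤ b.1.1 → a.1.2 ≤ b.1.2 → T a ≤ T b := by
    rintro ⟨⟨i, j⟩, ha⟩ ⟨⟨i', j'⟩, hb⟩ h1 h2
    simp only at h1 h2
    have hc : (i', j) ∈ s.cells := by
      rw [mem_cells_iff] at ha hb ⊢
      exact ⟨s.outer.up_left_mem le_rfl h2 hb.1,
        fun h' => ha.2 (s.inner.up_left_mem h1 le_rfl h')⟩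
    exact (hcol ⟨_, ha⟩ ⟨_, hc⟩ rfl h1).trans (hrow ⟨_, hc⟩ ⟨_, hb⟩ rfl h2)
  let κ : YoungDiagram := ⟨s.outer.cells.filter fun c => ∀ h : c ∈ s.cells, T ⟨c, h⟩ ≠ Fin.last m,
    by
      intro b a hab hb
      rw [Finset.mem_coe, Finset.mem_filter] at hb ⊢
      have ha : a ∈ s.outer := s.outer.isLowerSet hab hb.1
      refine ⟨ha, fun h hlast => ?_⟩
      have h1 : b ∈ s.cells := by
        rw [mem_cells_iff] at h ⊢
        exact ⟨hb.1, fun h' => h.2 (s.inner.isLowerSet hab h')⟩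
      refine hb.2 h1 (le_antisymm (Fin.le_last _) ?_)
      rw [← hlast]
      exact hmono ⟨a, h⟩ ⟨b, h1⟩ hab.1 hab.2⟩
  have hκ : ∀ c, c ∈ κ ↔ c ∈ s.outer ∧ ∀ h : c ∈ s.cells, T ⟨c, h⟩ ≠ Fin.last m := by
    intro c
    rw [← YoungDiagram.mem_cells, ← YoungDiagram.mem_cells]
    exact Finset.mem_filter
  have h₁ : s.inner ≤ κ := fun c hc => (hκ c).2 ⟨s.le hc, fun h => ((mem_cells_iff.1 h).2 hc).elim⟩
  have h₂ : κ ≤ s.outer := fun c hc => ((hκ c).1 hc).1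
  obtain ⟨u, hu, husize, hucells⟩ := hstrip (Fin.last m)
  have hcells : SkewPartition.cells ⟨s.outer, κ, h₂⟩ = u.cells := by
    ext c
    rw [hucells, mem_cells_iff, hκ]
    constructor
    · rintro ⟨h3, h4⟩
      by_contra h5
      exact h4 ⟨h3, fun h h6 => h5 ⟨h, h6⟩⟩
    · rintro ⟨h, h3⟩
      exact ⟨(mem_cells_iff.1 h).1, fun h4 => h4.2 h h3⟩
  have hsub : ∀ c, c ∈ SkewPartition.cells ⟨κ, s.inner, h₁⟩ ↔
      ∃ h : c ∈ s.cells, T ⟨c, h⟩ ≠ Fin.last m := by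
    intro c
    rw [mem_cells_iff]
    simp only [hκ]
    constructor
    · rintro ⟨⟨h3, h4⟩, h5⟩
      exact ⟨mem_cells_iff.2 ⟨h3, h5⟩, h4 _⟩
    · rintro ⟨h, h3⟩
      exact ⟨⟨(mem_cells_iff.1 h).1, fun _ => h3⟩, (mem_cells_iff.1 h).2⟩
  refine ⟨κ, h₁, h₂, ?_, ?_, fun c => (T ⟨c.1, ((hsub c.1).1 c.2).1⟩).castLT
    (Fin.val_lt_last ((hsub c.1).1 c.2).2), ?_, ?_, ?_⟩
  · unfold SkewPartition.IsBorderStrip at hu ⊢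
    rwa [hcells]
  · rw [SkewPartition.size, hcells]
    exact husize
  · intro a b hab hab'
    exact hrow ⟨a.1, _⟩ ⟨b.1, _⟩ hab hab'
  · intro a b hab hab'
    exact hcol ⟨a.1, _⟩ ⟨b.1, _⟩ hab hab'
  · intro j
    obtain ⟨v, hv, hvsize, hvcells⟩ := hstrip j.castSucc
    refine ⟨v, hv, hvsize, fun c => ?_⟩
    rw [hvcells]
    constructor
    · rintro ⟨h, h3⟩
      refine ⟨(hsub c).2 ⟨h, ?_⟩, ?_⟩
      · rw [h3]
        exact (Fin.castSucc_lt_last j).ne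
      · apply Fin.ext
        simp [h3]
    · rintro ⟨h, h3⟩
      refine ⟨((hsub c).1 h).1, Fin.ext ?_⟩
      have := congrArg Fin.val h3
      simpa using this

/-- Adding a border strip at the outer rim. -/
theorem SkewChar.SkewPartition.IsDecomposable.succ {μ κ ν : YoungDiagram} {m n : ℕ} (h₁ : μ ≤ κ) (h₂ : κ ≤ ν)
    (hstrip : SkewPartition.IsBorderStrip ⟨ν, κ, h₂⟩)
    (hsize : SkewPartition.size ⟨ν, κ, h₂⟩ = n)
    (hdec : SkewPartition.IsDecomposable ⟨κ, μ, h₁⟩ m n) :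
    SkewPartition.IsDecomposable ⟨ν, μ, h₁.trans h₂⟩ (m + 1) n := by
  classical
  obtain ⟨T, hrow, hcol, hT⟩ := hdec
  have hin : ∀ c, c ∈ SkewPartition.cells ⟨ν, μ, h₁.trans h₂⟩ → c ∈ κ →
      c ∈ SkewPartition.cells ⟨κ, μ, h₁⟩ := fun c hc h =>
    mem_cells_iff.2 ⟨h, (mem_cells_iff.1 hc).2⟩
  let T' : SkewPartition.cells ⟨ν, μ, h₁.trans h₂⟩ → Fin (m + 1) := fun c =>
    if h : c.1 ∈ κ then (T ⟨c.1, hin c.1 c.2 h⟩).castSucc else Fin.last m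
  have hpos : ∀ c (h : c.1 ∈ κ), T' c = (T ⟨c.1, hin c.1 c.2 h⟩).castSucc := fun c h => dif_pos h
  have hneg : ∀ c, c.1 ∉ κ → T' c = Fin.last m := fun c h => dif_neg h
  refine ⟨T', ?_, ?_, ?_⟩
  · intro a b hab hab'
    by_cases hb : b.1 ∈ κ
    · have ha : a.1 ∈ κ := κ.isLowerSet (show a.1 ≤ b.1 from ⟨hab.le, hab'⟩) hb
      rw [hpos a ha, hpos b hb]
      exact Fin.castSucc_le_castSucc_iff.2 (hrow _ _ hab hab')
    · rw [hneg b hb]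
      exact Fin.le_last _
  · intro a b hab hab'
    by_cases hb : b.1 ∈ κ
    · have ha : a.1 ∈ κ := κ.isLowerSet (show a.1 ≤ b.1 from ⟨hab', hab.le⟩) hb
      rw [hpos a ha, hpos b hb]
      exact Fin.castSucc_le_castSucc_iff.2 (hcol _ _ hab hab')
    · rw [hneg b hb]
      exact Fin.le_last _
  · intro j
    induction j using Fin.lastCases with
    | last =>
      refine ⟨_, hstrip, hsize, fun c => ?_⟩
      constructor
      · intro hc
        rw [mem_cells_iff] at hc
        exact ⟨mem_cells_iff.2 ⟨hc.1, fun h => hc.2 (h₁ h)⟩, hneg _ hc.2⟩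
      · rintro ⟨h, h3⟩
        refine mem_cells_iff.2 ⟨(mem_cells_iff.1 h).1, fun h4 => ?_⟩
        rw [hpos _ h4] at h3
        exact (Fin.castSucc_lt_last _).ne h3
    | cast j =>
      obtain ⟨u, hu, husize, hucells⟩ := hT j
      refine ⟨u, hu, husize, fun c => ?_⟩
      rw [hucells]
      constructor
      · rintro ⟨h, h3⟩
        have h4 := mem_cells_iff.1 h
        refine ⟨mem_cells_iff.2 ⟨h₂ h4.1, h4.2⟩, ?_⟩
        rw [hpos _ h4.1, h3]
      · rintro ⟨h, h3⟩
        by_cases h4 : c ∈ κ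
        · rw [hpos _ h4] at h3
          exact ⟨hin c h h4, Fin.castSucc_injective _ h3⟩
        · rw [hneg _ h4] at h3
          exact ((Fin.castSucc_lt_last _).ne h3.symm).elim

/-- A bead set dominates another one on an `n`-runner abacus if the two have equally many beads on
each runner and the former has at least as many beads as the latter beyond every position of every
runner. -/
def Dominates (n : ℕ) (X Y : Finset ℕ) : Prop :=
  (∀ q < n, runnerBeadsFrom n X q = runnerBeadsFrom n Y q) ∧
    ∀ q, runnerBeadsFrom n Y q ≤ runnerBeadsFrom n X q

theorem beadsFrom_eq_sum_runnerBeadsFrom {n : ℕ} (hn : 0 < n) (X : Finset ℕ) (q : ℕ) :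
    beadsFrom X q = ∑ i ∈ Finset.range n, runnerBeadsFrom n X (q + i) := by
  rw [beadsFrom, Finset.card_eq_sum_card_fiberwise (f := fun x => (x - q) % n)
    (t := Finset.range n)]
  · refine Finset.sum_congr rfl fun i hi => ?_
    rw [Finset.mem_range] at hi
    rw [runnerBeadsFrom, Finset.filter_filter]
    congr 1
    refine Finset.filter_congr fun x _ => ?_
    constructor
    · rintro ⟨h1, h2⟩
      obtain ⟨k, rfl⟩ := Nat.exists_eq_add_of_le h1
      rw [Nat.add_sub_cancel_left] at h2
      refine ⟨?_, ?_⟩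
      · have := Nat.mod_le k n
        omega
      · rw [← h2]
        simp
    · rintro ⟨h1, h2⟩
      obtain ⟨k, rfl⟩ := Nat.exists_eq_add_of_le (show q ≤ x by omega)
      refine ⟨by omega, ?_⟩
      rw [Nat.add_sub_cancel_left]
      have h3 : k ≡ i [MOD n] := Nat.ModEq.add_left_cancel' q h2
      rw [h3, Nat.mod_eq_of_lt hi]
  · intro x _
    exact Finset.mem_coe.2 (Finset.mem_range.2 (Nat.mod_lt _ hn))

theorem Dominates.beadsFrom_le {n : ℕ} (hn : 0 < n) {X Y : Finset ℕ} (h : Dominates n X Y)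
    (q : ℕ) : beadsFrom Y q ≤ beadsFrom X q := by
  rw [beadsFrom_eq_sum_runnerBeadsFrom hn, beadsFrom_eq_sum_runnerBeadsFrom hn]
  exact Finset.sum_le_sum fun i _ => h.2 _

theorem Dominates.refl (n : ℕ) (X : Finset ℕ) : Dominates n X X := ⟨fun _ _ => rfl, fun _ => le_rfl⟩

/-- A set of beads that strictly dominates another one has a bead that can be moved up on its
runner so that dominance is preserved. -/
theorem Dominates.exists_move {n : ℕ} (hn : 0 < n) {X Y : Finset ℕ} (h : Dominates n X Y)
    (hne : X ≠ Y) : ∃ p, p + n ∈ X ∧ p ∉ X ∧ Dominates n (insert p (X.erase (p + n))) Y := by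
  classical
  have hex : ∃ p, p ∈ X ∧ runnerBeadsFrom n Y p < runnerBeadsFrom n X p := by
    by_contra! hle
    -- downward induction on `q`, starting beyond the last bead
    have heq : ∀ k q, X.sup id < q + k → runnerBeadsFrom n X q = runnerBeadsFrom n Y q := by
      intro k
      induction k with
      | zero =>
        intro q hq
        have h1 : runnerBeadsFrom n X q = 0 := by
          rw [runnerBeadsFrom, Finset.card_eq_zero]
          refine Finset.filter_eq_empty_iff.2 fun x hx h2 => ?_
          have := Finset.le_sup (f := id) hx
          simp only [id] at this
          omega
        have h2 := h.2 q
        omega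
      | succ k ih =>
        intro q hq
        by_cases hqX : q ∈ X
        · exact le_antisymm (hle q hqX) (h.2 q)
        · have h1 := ih (q + n) (by omega)
          have h2 := runnerBeadsFrom_eq_add hn X q
          have h3 := runnerBeadsFrom_eq_add hn Y q
          have h4 := h.2 q
          rw [if_neg hqX] at h2
          omega
    refine hne (Finset.ext fun q => ?_)
    have h1 := heq (X.sup id + 1) q (by omega)
    have h2 := heq (X.sup id + 1) (q + n) (by omega)
    have h3 := runnerBeadsFrom_eq_add hn X q
    have h4 := runnerBeadsFrom_eq_add hn Y q
    split_ifs at h3 h4 with h5 h6 <;> simp_all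
  -- the first bead of `X` beyond which there is an excess cannot be blocked: a bead of `X` right above
  -- it on its runner would already have an excess
  obtain ⟨hp, hlt⟩ := Nat.find_spec hex
  have hmin := fun q => Nat.find_min hex (m := q)
  set P := Nat.find hex
  have hP : n ≤ P := by
    by_contra! hPn
    have := h.1 P hPn
    omega
  obtain ⟨p, hpP⟩ := Nat.exists_eq_add_of_le' hP
  rw [hpP] at hp hlt
  have hpX : p ∉ X := by
    intro hpX
    refine hmin p (by omega) ⟨hpX, ?_⟩
    have h3 := runnerBeadsFrom_eq_add hn X p
    have h4 := runnerBeadsFrom_eq_add hn Y p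
    rw [if_pos hpX] at h3
    split_ifs at h4 <;> omega
  refine ⟨p, hp, hpX, fun q hq => ?_, fun q => ?_⟩
  · have h1 := runnerBeadsFrom_move hn hp hpX q
    have h2 := h.1 q hq
    rw [if_neg (by omega)] at h1
    omega
  · have h1 := runnerBeadsFrom_move hn hp hpX q
    have h2 := h.2 q
    split_ifs at h1 with h3
    · subst h3
      omega
    · omega

/-- Removing the strips of a tableau one by one moves beads up on their runners. -/
theorem SkewChar.SkewPartition.IsDecomposable.dominates {m n : ℕ} (hn : 0 < n) {s : SkewPartition} {N : ℕ}
    (hN : s.outer.colLen 0 ≤ N) (hs : s.IsDecomposable m n) :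
    Dominates n (beadSet s.outer N) (beadSet s.inner N) := by
  induction m generalizing s with
  | zero =>
    rw [isDecomposable_zero] at hs
    have h1 : s.outer = s.inner := by
      refine le_antisymm (fun c hc => ?_) s.le
      by_contra h2
      have h3 := mem_cells_iff.2 ⟨hc, h2⟩
      rw [Finset.card_eq_zero.1 hs] at h3
      simp at h3
    rw [h1]
    exact Dominates.refl _ _
  | succ m ih =>
    obtain ⟨κ, h₁, h₂, hstrip, hsize, hdec⟩ := hs.exists_of_succ
    have h3 := ih (s := ⟨κ, s.inner, h₁⟩) ((colLen_mono h₂ 0).trans hN) hdec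
    obtain ⟨p, hp⟩ := exists_beadsFrom_of_isBorderStrip (s := ⟨s.outer, κ, h₂⟩) hN hstrip
    rw [hsize] at hp
    obtain ⟨h4, h5, h6⟩ := eq_move_of_beadsFrom hn hp
    simp only at h3 h4 h5 h6
    rw [h6] at h3
    refine ⟨fun q hq => ?_, fun q => ?_⟩
    · rw [runnerBeadsFrom_move hn h4 h5, h3.1 q hq, if_neg (by omega), add_zero]
    · rw [runnerBeadsFrom_move hn h4 h5]
      exact (h3.2 q).trans (Nat.le_add_right _ _)

/-- Moving beads up on their runners, from the display of the outer partition to that of the inner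
one, removes border strips one by one. -/
theorem Dominates.isDecomposable {m n : ℕ} (hn : 0 < n) {s : SkewPartition} {N : ℕ}
    (hN : s.outer.colLen 0 ≤ N) (hs : s.size = m * n)
    (h : Dominates n (beadSet s.outer N) (beadSet s.inner N)) : s.IsDecomposable m n := by
  induction m generalizing s with
  | zero => rw [isDecomposable_zero, hs, zero_mul]
  | succ m ih =>
    have hN' : s.inner.colLen 0 ≤ N := (colLen_mono s.le 0).trans hN
    have hcard := size_add_card_inner s
    have hne : beadSet s.outer N ≠ beadSet s.inner N := by
      intro heq
      rw [eq_of_beadSet_eq hN hN' heq, hs, Nat.succ_mul] at hcard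
      omega
    obtain ⟨p, hp, hp', hdom⟩ := h.exists_move hn hne
    set Y := insert p ((beadSet s.outer N).erase (p + n)) with hY
    have hYcard : Y.card = N := by
      rw [hY, Finset.card_insert_of_notMem fun h => hp' (Finset.mem_of_mem_erase h),
        Finset.card_erase_of_mem hp, card_beadSet]
      have := Finset.card_pos.2 ⟨_, hp⟩
      rw [card_beadSet] at this
      omega
    have hκ := beadSet_partitionOfBeads hYcard
    have hκN := colLen_partitionOfBeads_le Y
    rw [hYcard] at hκN
    set κ := partitionOfBeads Y
    have hmove := beadsFrom_move hp hp'
    rw [← hY, ← hκ] at hmove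
    have h₂ : κ ≤ s.outer := (le_iff_beadsFrom_le hκN hN).2 fun q => by
      rw [hmove q]
      exact Nat.le_add_right _ _
    rw [← hκ] at hdom
    have h₁ : s.inner ≤ κ := (le_iff_beadsFrom_le hN' hκN).2 (hdom.beadsFrom_le hn)
    obtain ⟨hstrip, hsize⟩ :=
      isBorderStrip_of_beadsFrom (s := ⟨s.outer, κ, h₂⟩) hn hN hmove
    refine SkewPartition.IsDecomposable.succ h₁ h₂ hstrip hsize (ih (s := ⟨κ, s.inner, h₁⟩) hκN ?_ hdom)
    have h5 := size_add_card_inner ⟨s.outer, κ, h₂⟩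
    have h6 := size_add_card_inner ⟨κ, s.inner, h₁⟩
    simp only at h5 h6
    rw [hs, Nat.succ_mul] at hcard
    omega

theorem runnerBeadsFrom_image {n N : ℕ} {a : Fin N → ℕ} (ha : Function.Injective a) (q : ℕ) :
    runnerBeadsFrom n (Finset.univ.image a) q =
      (Finset.univ.filter fun i => q ≤ a i ∧ a i % n = q % n).card := by
  rw [runnerBeadsFrom, Finset.filter_image, Finset.card_image_of_injective _ ha]

/-- Dominance follows from any matching of the beads in which every bead moves up on its runner. -/
theorem dominates_of_perm {n N : ℕ} {a b : Fin N → ℕ} (ha : Function.Injective a)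
    (hb : Function.Injective b) (π : Equiv.Perm (Fin N)) (hle : ∀ i, b (π i) ≤ a i)
    (hmod : ∀ i, b (π i) % n = a i % n) :
    Dominates n (Finset.univ.image a) (Finset.univ.image b) := by
  refine ⟨fun q hq => ?_, fun q => ?_⟩
  · rw [runnerBeadsFrom_image ha, runnerBeadsFrom_image hb]
    have hq' : ∀ x, (q ≤ x ∧ x % n = q % n) ↔ x % n = q % n := by
      intro x
      refine ⟨And.right, fun h => ⟨?_, h⟩⟩
      rw [Nat.mod_eq_of_lt hq] at h
      rw [← h]
      exact Nat.mod_le _ _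
    simp only [hq']
    refine Finset.card_bij' (fun i _ => π i) (fun i _ => π.symm i) ?_ ?_ ?_ ?_
    · intro i hi
      simpa [hmod] using hi
    · intro i hi
      simpa [← hmod] using hi
    · intro i _
      simp
    · intro i _
      simp
  · rw [runnerBeadsFrom_image ha, runnerBeadsFrom_image hb]
    refine Finset.card_le_card_of_injOn (fun i => π.symm i) ?_ (π.symm.injective.injOn)
    intro i hi
    have h1 := hle (π.symm i)
    have h2 := hmod (π.symm i)
    rw [π.apply_symm_apply] at h1 h2
    simp only [Finset.coe_filter, Finset.mem_univ, true_and, Set.mem_ofPred_eq] at hi ⊢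
    exact ⟨hi.1.trans h1, by rw [← h2, hi.2]⟩

/-! ### Runners and quotients -/

/-- The rows of the beads on runner `r` of an `n`-runner abacus. -/
def runnerSet (n : ℕ) (X : Finset ℕ) (r : ℕ) : Finset ℕ :=
  (X.filter fun p => p % n = r).image fun p => p / n

theorem mem_runnerSet {n : ℕ} {X : Finset ℕ} {r x : ℕ} (hr : r < n) :
    x ∈ runnerSet n X r ↔ n * x + r ∈ X := by
  simp only [runnerSet, Finset.mem_image, Finset.mem_filter]
  constructor
  · rintro ⟨p, ⟨hp, rfl⟩, rfl⟩
    rwa [Nat.div_add_mod]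
  · intro h
    refine ⟨_, ⟨h, ?_⟩, ?_⟩
    · rw [Nat.mul_add_mod, Nat.mod_eq_of_lt hr]
    · rw [Nat.mul_add_div (by omega), Nat.div_eq_of_lt hr, add_zero]

theorem beadsFrom_runnerSet {n : ℕ} (X : Finset ℕ) {r : ℕ} (hr : r < n) (q : ℕ) :
    beadsFrom (runnerSet n X r) q = runnerBeadsFrom n X (n * q + r) := by
  rw [beadsFrom, runnerBeadsFrom]
  refine Finset.card_bij (fun x _ => n * x + r) ?_ ?_ ?_
  · intro x hx
    rw [Finset.mem_filter, mem_runnerSet hr] at hx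
    rw [Finset.mem_filter, Nat.mul_add_mod, Nat.mul_add_mod]
    exact ⟨hx.1, by gcongr; exact hx.2, rfl⟩
  · intro x _ y _ hxy
    have h1 := Nat.add_right_cancel hxy
    exact Nat.eq_of_mul_eq_mul_left (by omega) h1
  · intro p hp
    rw [Finset.mem_filter, Nat.mul_add_mod, Nat.mod_eq_of_lt hr] at hp
    obtain ⟨hp, hle, hmod⟩ := hp
    have h1 := Nat.div_add_mod p n
    rw [hmod] at h1
    refine ⟨p / n, ?_, h1⟩
    rw [Finset.mem_filter, mem_runnerSet hr, h1]
    refine ⟨hp, ?_⟩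
    rw [← h1] at hle
    exact Nat.le_of_mul_le_mul_left (Nat.le_of_add_le_add_right hle) (by omega)

theorem card_runnerSet {n : ℕ} (X : Finset ℕ) {r : ℕ} (hr : r < n) :
    (runnerSet n X r).card = runnerBeadsFrom n X r := by
  have h := beadsFrom_runnerSet X hr 0
  rw [mul_zero, zero_add] at h
  rw [← h, beadsFrom]
  simp

theorem sum_eq_sum_runnerSet {n : ℕ} (hn : 0 < n) (X : Finset ℕ) :
    ∑ x ∈ X, x = ∑ r : Fin n, ∑ x ∈ runnerSet n X r, (n * x + r) := by
  have h : ∀ r : Fin n, ∑ x ∈ runnerSet n X r, (n * x + r) =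
      ∑ p ∈ X.filter fun p => (⟨p % n, Nat.mod_lt _ hn⟩ : Fin n) = r, p := by
    intro r
    have h1 : (X.filter fun p => (⟨p % n, Nat.mod_lt _ hn⟩ : Fin n) = r) =
        (runnerSet n X r).image fun x => n * x + r := by
      ext p
      simp only [Finset.mem_filter, Fin.ext_iff, Finset.mem_image]
      constructor
      · rintro ⟨hp, hr⟩
        have h1 := Nat.div_add_mod p n
        rw [hr] at h1
        exact ⟨p / n, by rwa [mem_runnerSet r.2, h1], h1⟩
      · rintro ⟨x, hx, rfl⟩
        exact ⟨(mem_runnerSet r.2).1 hx, by rw [Nat.mul_add_mod, Nat.mod_eq_of_lt r.2]⟩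
    rw [h1, Finset.sum_image]
    intro x _ y _ hxy
    exact Nat.eq_of_mul_eq_mul_left hn (Nat.add_right_cancel hxy)
  rw [Finset.sum_congr rfl fun r _ => h r]
  exact (Finset.sum_fiberwise X _ _).symm

theorem beadSet_quotientComponent {ν : YoungDiagram} {N n c : ℕ} {i : Fin n}
    (hc : (runnerSet n (beadSet ν N) i).card = c) :
    beadSet (quotientComponent ν N n i) c = runnerSet n (beadSet ν N) i :=
  beadSet_partitionOfBeads hc

theorem colLen_quotientComponent_le {ν : YoungDiagram} {N n c : ℕ} {i : Fin n}
    (hc : (runnerSet n (beadSet ν N) i).card = c) :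
    (quotientComponent ν N n i).colLen 0 ≤ c :=
  hc ▸ colLen_partitionOfBeads_le _

theorem Dominates.card_runnerSet_eq {n : ℕ} {X Y : Finset ℕ} (h : Dominates n X Y) (i : Fin n) :
    (runnerSet n Y i).card = (runnerSet n X i).card := by
  rw [card_runnerSet _ i.2, card_runnerSet _ i.2, h.1 i i.2]

theorem Dominates.quotientComponent_le {n N : ℕ} {μ ν : YoungDiagram}
    (h : Dominates n (beadSet ν N) (beadSet μ N)) (i : Fin n) :
    quotientComponent μ N n i ≤ quotientComponent ν N n i := by
  have hc := h.card_runnerSet_eq i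
  rw [le_iff_beadsFrom_le (colLen_quotientComponent_le hc) (colLen_quotientComponent_le rfl),
    beadSet_quotientComponent hc, beadSet_quotientComponent rfl]
  intro q
  rw [beadsFrom_runnerSet _ i.2, beadsFrom_runnerSet _ i.2]
  exact h.2 _

/-- The size of a partition in terms of its quotient and its numbers of beads on the runners. -/
theorem card_add_eq_mul_sum_quotient {ν : YoungDiagram} {N n : ℕ} (hn : 0 < n)
    (hN : ν.colLen 0 ≤ N) {c : Fin n → ℕ}
    (hc : ∀ i : Fin n, (runnerSet n (beadSet ν N) i).card = c i) :
    ν.card + ∑ i ∈ Finset.range N, i = n * (∑ i, (quotientComponent ν N n i).card) +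
      ∑ i : Fin n, (n * (∑ j ∈ Finset.range (c i), j) + c i * i) := by
  rw [← sum_beadSet hN, sum_eq_sum_runnerSet hn, Finset.mul_sum, ← Finset.sum_add_distrib]
  refine Finset.sum_congr rfl fun i _ => ?_
  have h1 := sum_beadSet (colLen_quotientComponent_le (hc i))
  rw [beadSet_quotientComponent (hc i)] at h1
  rw [Finset.sum_add_distrib, ← Finset.mul_sum, h1, Finset.sum_const, hc, smul_eq_mul]
  ring

theorem Dominates.sum_size_skewQuotient {m n N : ℕ} (hn : 0 < n) {s : SkewPartition}
    (hN : s.outer.colLen 0 ≤ N) (hs : s.size = m * n)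
    (h : Dominates n (beadSet s.outer N) (beadSet s.inner N)) :
    ∑ i, (skewQuotient s N n h.quotientComponent_le i).size = m := by
  have h1 := card_add_eq_mul_sum_quotient hn hN (fun _ => rfl)
  have h2 := card_add_eq_mul_sum_quotient hn ((colLen_mono s.le 0).trans hN) h.card_runnerSet_eq
  have h3 := size_add_card_inner s
  have h4 : ∑ i, (skewQuotient s N n h.quotientComponent_le i).size +
      ∑ i, (quotientComponent s.inner N n i).card =
      ∑ i, (quotientComponent s.outer N n i).card := by
    rw [← Finset.sum_add_distrib]
    exact Finset.sum_congr rfl fun i _ => size_add_card_inner (skewQuotient s N n h.quotientComponent_le i)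
  rw [← h4, mul_add] at h1
  refine Nat.eq_of_mul_eq_mul_left hn ?_
  rw [hs, mul_comm] at h3
  omega

/-- The beads of an abacus display are numbered by runner and level, and the bead of level `l` on
runner `r` corresponds to the bead numbered `l` in the display of the `r`-th component of the
quotient. -/
theorem exists_runner_level_equiv {ν : YoungDiagram} {N n : ℕ} (hn : 0 < n) {c : Fin n → ℕ}
    (hc : ∀ i : Fin n, (runnerSet n (beadSet ν N) i).card = c i) :
    ∃ φ : (Σ r : Fin n, Fin (c r)) ≃ Fin N, ∀ z,
      beadPos ν N (φ z) = n * beadPos (quotientComponent ν N n z.1) (c z.1) z.2 + z.1 ∧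
      level ν N n (φ z) = z.2 := by
  have hex : ∀ z : Σ r : Fin n, Fin (c r), ∃ b,
      beadPos ν N b = n * beadPos (quotientComponent ν N n z.1) (c z.1) z.2 + z.1 := by
    intro z
    have h1 : beadPos (quotientComponent ν N n z.1) (c z.1) z.2 ∈
        beadSet (quotientComponent ν N n z.1) (c z.1) :=
      Finset.mem_image_of_mem _ (Finset.mem_univ _)
    rw [beadSet_quotientComponent (hc z.1), mem_runnerSet z.1.2] at h1
    obtain ⟨b, -, hb⟩ := Finset.mem_image.1 h1
    exact ⟨b, hb⟩
  choose f hf using hex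
  have hdiv : ∀ x (r : Fin n), (n * x + r) / n = x := fun x r => by
    rw [Nat.mul_add_div hn, Nat.div_eq_of_lt r.2, add_zero]
  have hmod : ∀ x (r : Fin n), (n * x + r) % n = r := fun x r => by
    rw [Nat.mul_add_mod, Nat.mod_eq_of_lt r.2]
  have hinj : Function.Injective f := by
    rintro ⟨r, l⟩ ⟨r', l'⟩ h
    have h1 := hf ⟨r, l⟩
    rw [h, hf] at h1
    obtain rfl : r = r' := by
      have h2 := congrArg (· % n) h1
      simp only [hmod] at h2
      exact (Fin.ext h2).symm
    have h2 := congrArg (· / n) h1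
    simp only [hdiv] at h2
    rw [(beadPos_strictMono _ _).injective h2]
  have hsurj : Function.Surjective f := by
    intro b
    let r : Fin n := ⟨beadPos ν N b % n, Nat.mod_lt _ hn⟩
    have h1 := Nat.div_add_mod (beadPos ν N b) n
    have h2 : beadPos ν N b / n ∈ runnerSet n (beadSet ν N) r := by
      rw [mem_runnerSet r.2, h1]
      exact Finset.mem_image_of_mem _ (Finset.mem_univ _)
    rw [← beadSet_quotientComponent (hc r)] at h2
    obtain ⟨l, -, hl⟩ := Finset.mem_image.1 h2
    refine ⟨⟨r, l⟩, (beadPos_strictMono ν N).injective ?_⟩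
    rw [hf]
    simp only [hl]
    exact h1
  refine ⟨Equiv.ofBijective f ⟨hinj, hsurj⟩, fun z => ⟨hf z, ?_⟩⟩
  obtain ⟨r, l⟩ := z
  change level ν N n (f ⟨r, l⟩) = l
  rw [level]
  have h1 : (Finset.univ.filter fun b : Fin N => beadPos ν N b % n = beadPos ν N (f ⟨r, l⟩) % n ∧
      beadPos ν N b < beadPos ν N (f ⟨r, l⟩)) = (Finset.Iio l).image fun l' => f ⟨r, l'⟩ := by
    ext b
    obtain ⟨⟨r', l'⟩, rfl⟩ := hsurj b
    simp only [Finset.mem_filter, Finset.mem_univ, true_and, hf, hmod, Finset.mem_image,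
      Finset.mem_Iio]
    constructor
    · rintro ⟨h2, h3⟩
      obtain rfl : r' = r := Fin.ext h2
      refine ⟨l', ?_, rfl⟩
      have h4 := Nat.lt_of_mul_lt_mul_left (Nat.lt_of_add_lt_add_right h3)
      exact (beadPos_strictMono _ _).lt_iff_lt.1 h4
    · rintro ⟨l'', h2, h3⟩
      have h4 := hinj h3
      obtain ⟨rfl, h4⟩ := Sigma.mk.inj_iff.1 h4
      obtain rfl := eq_of_heq h4
      refine ⟨rfl, ?_⟩
      have := (Nat.mul_lt_mul_left hn).2 (beadPos_strictMono (quotientComponent ν N n r) (c r) h2)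
      omega
  rw [h1, Finset.card_image_of_injective, Fin.card_Iio]
  intro a b hab
  simpa using hinj hab

/-! ### Factorization over the runners -/

theorem sign_sigmaCongrRight {ι : Type*} [Fintype ι] [DecidableEq ι] {A : ι → Type*}
    [∀ i, Fintype (A i)] [∀ i, DecidableEq (A i)] (F : ∀ i, Equiv.Perm (A i)) :
    Equiv.Perm.sign (Equiv.Perm.sigmaCongrRight F) = ∏ i, Equiv.Perm.sign (F i) := by
  let S : (∀ i, Equiv.Perm (A i)) →* ℤˣ :=
    { toFun := fun F => ∏ i, Equiv.Perm.sign (F i)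
      map_one' := by simp
      map_mul' := fun F F' => by simp [Finset.prod_mul_distrib] }
  have h : Equiv.Perm.sign.comp (Equiv.Perm.sigmaCongrRightHom A) = S := by
    refine MonoidHom.pi_ext fun i σ => ?_
    have h1 : S (Pi.mulSingle i σ) = Equiv.Perm.sign σ := by
      change ∏ j, Equiv.Perm.sign ((Pi.mulSingle i σ : ∀ j, Equiv.Perm (A j)) j) = _
      rw [Finset.prod_eq_single i]
      · rw [Pi.mulSingle_eq_same]
      · intro j _ hj
        rw [Pi.mulSingle_eq_of_ne hj, Equiv.Perm.sign_one]
      · simp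
    rw [h1]
    symm
    refine Equiv.Perm.sign_bij (fun x _ => (⟨i, x⟩ : Σ i, A i)) ?_ ?_ ?_
    · intro x _ _
      change _ = (⟨i, (Pi.mulSingle i σ : ∀ j, Equiv.Perm (A j)) i x⟩ : Σ i, A i)
      rw [Pi.mulSingle_eq_same]
    · intro x y _ _ hxy
      simpa using hxy
    · rintro ⟨j, y⟩ hy
      change (⟨j, (Pi.mulSingle i σ : ∀ j, Equiv.Perm (A j)) j y⟩ : Σ i, A i) ≠ _ at hy
      by_cases hj : j = i
      · subst hj
        rw [Pi.mulSingle_eq_same] at hy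
        exact ⟨y, fun h => hy (by rw [h]), rfl⟩
      · rw [Pi.mulSingle_eq_of_ne hj] at hy
        simp at hy
  exact DFunLike.congr_fun h F

/-- Induction from a Young subgroup is multilinear in the class functions on the factors. -/
theorem youngInduced_sum {k r : ℕ} (ℓ : Fin k → ℕ) (h : ∑ i, ℓ i = r) {I : Fin k → Type*}
    [∀ i, Fintype (I i)] (w : ∀ i, I i → ℂ) (θ : ∀ i, I i → Equiv.Perm (Fin (ℓ i)) → ℂ)
    (g : Equiv.Perm (Fin r)) :
    youngInduced ℓ h (fun i y => ∑ j, w i j * θ i j y) g =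
      ∑ F : ∀ i, I i, (∏ i, w i (F i)) * youngInduced ℓ h (fun i => θ i (F i)) g := by
  unfold youngInduced inducedClassFunction
  simp only [Finset.mul_sum]
  conv_rhs => rw [Finset.sum_comm]
  refine Finset.sum_congr rfl fun x _ => ?_
  conv_rhs => rw [Finset.sum_comm]
  refine Finset.sum_congr rfl fun y _ => ?_
  split_ifs
  · rw [Fintype.prod_sum, Finset.mul_sum]
    refine Finset.sum_congr rfl fun F _ => ?_
    rw [Finset.prod_mul_distrib]
    ring
  · simp

/-- At an element whose cycle lengths are all divisible by `n`, only the permutations of the beads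
that preserve the runners contribute, and these are the families of permutations of the beads on
the single runners. -/
theorem altColoringSum_runners {X Y : Type*} [Fintype X] [DecidableEq X] [Fintype Y]
    [DecidableEq Y] {n : ℕ} (hn : 0 < n) (g : Equiv.Perm X) (h : Equiv.Perm Y)
    (hgh : g.partition.parts = h.partition.parts.map fun a => n * a) {c : Fin n → ℕ}
    (x y : (Σ r : Fin n, Fin (c r)) → ℤ) :
    altColoringSum g (fun z => n * x z + (z.1 : ℕ)) (fun z => n * y z + (z.1 : ℕ)) =
      ∑ F : ∀ r, Equiv.Perm (Fin (c r)), (∏ r, (Equiv.Perm.sign (F r) : ℤ)) *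
        ((invColorings h fun z : Σ r : Fin n, Fin (c r) => x z - y ⟨z.1, F z.1 z.2⟩).card : ℤ) := by
  unfold altColoringSum
  symm
  refine Finset.sum_of_injOn (fun F => Equiv.Perm.sigmaCongrRight F)
    (Equiv.Perm.sigmaCongrRightHom_injective.injOn) (fun _ _ => by simp) ?_ ?_
  · intro τ _ hτ
    have h1 : ∃ z, (τ z).1 ≠ z.1 := by
      by_contra! h1
      obtain ⟨F, hF⟩ := exists_sigmaCongrRight_eq τ h1
      exact hτ ⟨F, by simp, hF⟩
    obtain ⟨z, hz⟩ := h1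
    rw [invColorings_eq_empty_of_not_dvd g h hgh (k := z), Finset.card_empty, Nat.cast_zero,
      mul_zero]
    intro hdvd
    refine hz (Fin.ext ?_)
    have h2 : (n : ℤ) ∣ ((z.1 : ℕ) : ℤ) - ((τ z).1 : ℕ) := by
      have h3 : ((z.1 : ℕ) : ℤ) - ((τ z).1 : ℕ) =
          (n * x z + (z.1 : ℕ) - (n * y (τ z) + ((τ z).1 : ℕ))) - n * (x z - y (τ z)) := by ring
      rw [h3]
      exact dvd_sub hdvd (dvd_mul_right _ _)
    have h4 := (Nat.modEq_iff_dvd.2 h2 : ((τ z).1 : ℕ) ≡ z.1 [MOD n])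
    rwa [Nat.ModEq, Nat.mod_eq_of_lt (τ z).1.2, Nat.mod_eq_of_lt z.1.2] at h4
  · intro F _
    rw [sign_sigmaCongrRight, ← card_invColorings_mul hn g h hgh]
    push_cast
    congr 4
    funext z
    simp only [Equiv.Perm.sigmaCongrRight, Equiv.sigmaCongrRight_apply]
    ring

theorem size_eq_sum_beadPos_sub (s : SkewPartition) {N : ℕ} (hN : s.outer.colLen 0 ≤ N)
    (π : Equiv.Perm (Fin N)) :
    ∑ i, ((beadPos s.outer N i : ℤ) - beadPos s.inner N (π i)) = s.size := by
  have h1 := sum_beadSet hN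
  have h2 := sum_beadSet ((colLen_mono s.le 0).trans hN)
  rw [beadSet, Finset.sum_image fun a _ b _ h => (beadPos_strictMono _ N).injective h] at h1 h2
  have h3 := size_add_card_inner s
  rw [Finset.sum_sub_distrib, Equiv.sum_comp π (fun i => (beadPos s.inner N i : ℤ))]
  zify at h1 h2 h3
  omega

/-- A skew character that does not vanish at an element whose cycle lengths are all divisible by
`n` provides a matching of the beads, hence dominance. -/
theorem dominates_of_skewCharacter_ne_zero {Y : Type*} [Fintype Y] [DecidableEq Y] {n N : ℕ}
    {s : SkewPartition} (hN : s.outer.colLen 0 ≤ N) (g : Equiv.Perm (Fin s.size))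
    (h : Equiv.Perm Y) (hgh : g.partition.parts = h.partition.parts.map fun a => n * a)
    (hne : skewCharacter s g ≠ 0) : Dominates n (beadSet s.outer N) (beadSet s.inner N) := by
  rw [skewCharacter_eq_altColoringSum s hN, Int.cast_ne_zero, altColoringSum] at hne
  obtain ⟨π, -, hπ⟩ := Finset.exists_ne_zero_of_sum_ne_zero hne
  have hne' := right_ne_zero_of_mul hπ
  refine dominates_of_perm (beadPos_strictMono _ N).injective (beadPos_strictMono _ N).injective π
    (fun i => ?_) (fun i => ?_)
  · by_contra hlt
    rw [invColorings_eq_empty_of_neg g (k := i) (by omega)] at hne'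
    simp at hne'
  · by_contra hmod
    rw [invColorings_eq_empty_of_not_dvd g h hgh (k := i)
      (fun hdvd => hmod (Nat.modEq_iff_dvd.2 hdvd))] at hne'
    simp at hne'

/-- The determinants over the single runners assemble to the induced product of the skew
characters of the components of the quotient. -/
theorem youngInduced_skewQuotient {m n N : ℕ} (s : SkewPartition)
    (hle : ∀ i : Fin n, quotientComponent s.inner N n i ≤ quotientComponent s.outer N n i)
    (hsum : ∑ i, (skewQuotient s N n hle i).size = m) {c : Fin n → ℕ}
    (hc : ∀ i : Fin n, (quotientComponent s.outer N n i).colLen 0 ≤ c i)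
    (h : Equiv.Perm (Fin m)) :
    youngInduced (fun i => (skewQuotient s N n hle i).size) hsum
        (fun i => skewCharacter (skewQuotient s N n hle i)) h =
      ((∑ F : ∀ r, Equiv.Perm (Fin (c r)), (∏ r, (Equiv.Perm.sign (F r) : ℤ)) *
        ((invColorings h fun z : Σ r : Fin n, Fin (c r) =>
          (beadPos (quotientComponent s.outer N n z.1) (c z.1) z.2 : ℤ) -
            beadPos (quotientComponent s.inner N n z.1) (c z.1) (F z.1 z.2)).card : ℤ) : ℤ) : ℂ) := by
  have h1 : (fun i => skewCharacter (skewQuotient s N n hle i)) = fun i y =>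
      ∑ π : Equiv.Perm (Fin (c i)), ((Equiv.Perm.sign π : ℤ) : ℂ) *
        ((invColorings y fun l : Fin (c i) =>
          (beadPos (quotientComponent s.outer N n i) (c i) l : ℤ) -
            beadPos (quotientComponent s.inner N n i) (c i) (π l)).card : ℂ) := by
    funext i y
    rw [skewCharacter_eq_altColoringSum (skewQuotient s N n hle i) (hc i), altColoringSum]
    push_cast
    rfl
  rw [h1, youngInduced_sum]
  push_cast
  refine Finset.sum_congr rfl fun F _ => ?_
  congr 1
  exact youngInduced_card_invColorings _ hsum (fun i l =>
    (beadPos (quotientComponent s.outer N n i) (c i) l : ℤ) -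
      beadPos (quotientComponent s.inner N n i) (c i) (F i l))
    (fun i => size_eq_sum_beadPos_sub (skewQuotient s N n hle i) (hc i) (F i)) h

open SkewChar in
/-- Here `g` is any permutation of cycle type `nα` and `h` any permutation of cycle type `α`, and
the abacus displays have `t * n` beads for any `t` for which these displays exist. In the
decomposable case it is part of the conclusion that the `n`-quotient is well defined and of total
size `m`, and that there is exactly one relabelling permutation, whose sign is the `n`-sign. -/
theorem theorem2p1 (m n : ℕ) (hn : 0 < n) (s : SkewPartition) (hs : s.size = m * n)
    (α : m.Partition)
    (g : Equiv.Perm (Fin s.size)) (hg : g.partition.parts = α.parts.map (fun a => n * a))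
    (h : Equiv.Perm (Fin m)) (hh : h.partition.parts = α.parts) :
    (¬ s.IsDecomposable m n → skewCharacter s g = 0) ∧
    (s.IsDecomposable m n → ∀ t : ℕ, s.outer.colLen 0 ≤ t * n →
      ∃ (hle : ∀ i : Fin n, quotientComponent s.inner (t * n) n i ≤
          quotientComponent s.outer (t * n) n i)
        (hsum : ∑ i, (skewQuotient s (t * n) n hle i).size = m),
        ∃ ρ : Equiv.Perm (Fin (t * n)), IsRelabelling s (t * n) n ρ ∧
          (∀ ρ', IsRelabelling s (t * n) n ρ' → ρ' = ρ) ∧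
          skewCharacter s g = ((Equiv.Perm.sign ρ : ℤ) : ℂ) *
            youngInduced (fun i => (skewQuotient s (t * n) n hle i).size) hsum
              (fun i => skewCharacter (skewQuotient s (t * n) n hle i)) h) := by
  have hgh : g.partition.parts = h.partition.parts.map fun a => n * a := by rw [hg, hh]
  refine ⟨fun hnot => ?_, fun hdec t hN => ?_⟩
  · by_contra hne
    exact hnot ((dominates_of_skewCharacter_ne_zero le_rfl g h hgh hne).isDecomposable hn
      le_rfl hs)
  have hdom := hdec.dominates hn hN
  obtain ⟨φ, hφ⟩ := exists_runner_level_equiv (ν := s.outer) (N := t * n) hn (fun _ => rfl)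
  obtain ⟨ψ, hψ⟩ := exists_runner_level_equiv hn hdom.card_runnerSet_eq
  have hmod : ∀ x (r : Fin n), (n * x + r) % n = r := fun x r => by
    rw [Nat.mul_add_mod, Nat.mod_eq_of_lt r.2]
  refine ⟨hdom.quotientComponent_le, hdom.sum_size_skewQuotient hn hN hs, φ.symm.trans ψ,
    fun b => ?_, fun ρ' hρ' => ?_, ?_⟩
  · obtain ⟨z, rfl⟩ := φ.surjective b
    rw [Equiv.trans_apply, φ.symm_apply_apply, (hφ z).1, (hφ z).2, (hψ z).1, (hψ z).2, hmod, hmod]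
    exact ⟨rfl, rfl⟩
  · refine Equiv.ext fun b => ?_
    obtain ⟨z, rfl⟩ := φ.surjective b
    obtain ⟨h1, h2⟩ := hρ' (φ z)
    obtain ⟨w, hw⟩ := ψ.surjective (ρ' (φ z))
    rw [← hw, (hφ z).1, (hψ w).1, hmod, hmod] at h1
    rw [← hw, (hφ z).2, (hψ w).2] at h2
    rw [Equiv.trans_apply, φ.symm_apply_apply, ← hw]
    congr 1
    obtain ⟨r, l⟩ := z
    obtain ⟨r', l'⟩ := w
    obtain rfl : r = r' := Fin.ext h1
    obtain rfl : l = l' := Fin.ext h2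
    rfl
  · rw [skewCharacter_eq_altColoringSum s hN, altColoringSum_eq_sign_mul _ _ _ φ ψ,
      youngInduced_skewQuotient s _ _ (fun i => colLen_quotientComponent_le rfl),
      ← altColoringSum_runners hn g h hgh
        (fun z => (beadPos (quotientComponent s.outer (t * n) n z.1) _ z.2 : ℤ))
        (fun z => (beadPos (quotientComponent s.inner (t * n) n z.1) _ z.2 : ℤ)), Int.cast_mul]
    congr 2
    congr 1
    · funext z
      simp [(hφ z).1]
    · funext z
      simp [(hψ z).1]
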